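/- Let $n\ge 2$. In the $n$-player Magic Square game, played on an $n\times n$ matrix with $\{0,1\}$-entries, the referee chooses one of the $n$ rows and $n$ columns uniformly at random, assigns its $n$ cells one-to-one to the $n$ players uniformly at random, and asks each player for the content of his cell. Each player answers $0$ or $1$. The players win if and only if the sum of the $n$ answers is even, except that, when the referee chose column $n$, they win if and only if the sum is odd. A commuting-operator strategy consists of a Hilbert space $\mathcal H$, a density operator $\rho$ on $\mathcal H$, and POVMs $(M^{(i)}_{q,a})_{a\in\{0,1\}}$ on $\mathcal H$ for every player $i$ and every cell $q$, such that $M^{(i)}_{q,a}$ and $M^{(i')}_{q',a'}$ commute whenever $i\ne i'$; on questions $q_1,\dots,q_n$ the players answer $a_1,\dots,a_n$ with probability $\operatorname{tr}\bigl(\rho\, M^{(1)}_{q_1,a_1}\cdots M^{(n)}_{q_n,a_n}\bigr)$. An entangled strategy is the special case in which $\mathcal H=\mathcal H_1\otimes\dots\otimes\mathcal H_n$ is a tensor product of Hilbert spaces and the POVMs of player $i$ act on the factor $\mathcal H_i$ only. Then the maximum winning probability in the $n$-player Magic Square game over all commuting-operator strategies exists and is equal to $$\frac{1+\cos\frac{\pi}{2n}}{2},$$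 and the same number is the maximum winning probability over all entangled strategies, whether the spaces $\mathcal H_i$ are arbitrary Hilbert spaces or are required to be finite-dimensional. -/

import Mathlib

/-! ## Hilbert space preliminaries: trace, states, POVMs -/

/-- An orthonormal (Hilbert) basis of a Hilbert space, fixed once and for all. -/
noncomputable def stdHilbertIndex (H : Type*) [NormedAddCommGroup H] [InnerProductSpace ℂ H]
    [CompleteSpace H] : Set H :=
  (exists_hilbertBasis ℂ H).choose

/-- An orthonormal (Hilbert) basis of a Hilbert space, fixed once and for all. -/
noncomputable def stdHilbertBasis (H : Type*) [NormedAddCommGroup H] [InnerProductSpace ℂ H]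
    [CompleteSpace H] : HilbertBasis (stdHilbertIndex H) ℂ H :=
  (exists_hilbertBasis ℂ H).choose_spec.choose

/-- The trace `∑ₑ ⟨e, T e⟩` over an orthonormal basis. For trace-class `T` (the only case used
below) the sum converges absolutely and does not depend on the basis. -/
noncomputable def opTrace {H : Type*} [NormedAddCommGroup H] [InnerProductSpace ℂ H]
    [CompleteSpace H] (T : H →L[ℂ] H) : ℂ :=
  ∑' e, inner ℂ (stdHilbertBasis H e) (T (stdHilbertBasis H e))

/-- A quantum state (density operator): a positive trace-class operator of trace one.
For a positive operator the trace sum has the same value, possibly infinite, in every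
orthonormal basis, so that convergence in one basis means being of trace class. -/
structure IsDensityOperator {H : Type*} [NormedAddCommGroup H] [InnerProductSpace ℂ H]
    [CompleteSpace H] (ρ : H →L[ℂ] H) : Prop where
  isPositive : ρ.IsPositive
  hasSum_trace : HasSum
    (fun e => inner ℂ (stdHilbertBasis H e) (ρ (stdHilbertBasis H e))) 1

/-- A POVM with outcomes in the finite set `A`. -/
structure IsPOVM {A : Type*} [Fintype A] {H : Type*} [NormedAddCommGroup H]
    [InnerProductSpace ℂ H] [CompleteSpace H] (M : A → H →L[ℂ] H) : Prop where
  isPositive : ∀ a, (M a).IsPositive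
  sum_eq_one : ∑ a, M a = 1

/-! ## The Hilbert tensor product of a finite family of Hilbert spaces -/

section HilbertTensor

open scoped TensorProduct ComplexConjugate

variable {m : ℕ} (H : Fin m → Type*) [∀ i, NormedAddCommGroup (H i)]
  [∀ i, InnerProductSpace ℂ (H i)]

/-- The algebraic tensor product, as a type synonym that is going to carry the tensor product
inner product `⟨⨂ᵢ xᵢ, ⨂ᵢ yᵢ⟩ = ∏ᵢ ⟨xᵢ, yᵢ⟩`. -/
def AlgTensor : Type _ := ⨂[ℂ] i, H i

noncomputable instance : AddCommGroup (AlgTensor H) :=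
  inferInstanceAs (AddCommGroup (⨂[ℂ] i, H i))

noncomputable instance : Module ℂ (AlgTensor H) :=
  inferInstanceAs (Module ℂ (⨂[ℂ] i, H i))

/-- The canonical multilinear map `x ↦ ⨂ᵢ xᵢ`. -/
noncomputable def AlgTensor.tprod : MultilinearMap ℂ H (AlgTensor H) :=
  PiTensorProduct.tprod ℂ

variable {H}

namespace AlgTensor

/-- Tensor products of linear operators. -/
noncomputable def map (f : ∀ i, H i →ₗ[ℂ] H i) : AlgTensor H →ₗ[ℂ] AlgTensor H :=
  PiTensorProduct.map f

theorem map_tprod (f : ∀ i, H i →ₗ[ℂ] H i) (x : ∀ i, H i) :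
    map f (tprod H x) = tprod H (fun i => f i (x i)) :=
  PiTensorProduct.map_tprod f x

theorem induction {p : AlgTensor H → Prop} (z : AlgTensor H)
    (hs : ∀ (c : ℂ) (x : ∀ i, H i), p (c • tprod H x))
    (ha : ∀ z w, p z → p w → p (z + w)) : p z :=
  PiTensorProduct.induction_on (motive := p) z hs ha

/-- The linear functional `⨂ᵢ yᵢ ↦ ∏ᵢ ⟨xᵢ, yᵢ⟩`. -/
noncomputable def innerPure (x : ∀ i, H i) : AlgTensor H →ₗ[ℂ] ℂ :=
  PiTensorProduct.lift
    ((MultilinearMap.mkPiAlgebra ℂ (Fin m) ℂ).compLinearMap (fun i => innerₛₗ ℂ (x i)))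

theorem innerPure_tprod (x y : ∀ i, H i) :
    innerPure x (tprod H y) = ∏ i, inner ℂ (x i) (y i) := by
  refine (PiTensorProduct.lift.tprod _).trans ?_
  simp

/-- For fixed `w`, the linear functional `⨂ᵢ xᵢ ↦ conj (innerPure x w)`. -/
noncomputable def conjInner (w : AlgTensor H) : AlgTensor H →ₗ[ℂ] ℂ :=
  PiTensorProduct.lift
    { toFun := fun x => conj (innerPure x w)
      map_update_add' := by
        intro inst x i a b
        obtain rfl : inst = instDecidableEqFin m := Subsingleton.elim _ _
        rw [← map_add]
        congr 1
        induction w using induction with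
        | hs c y =>
          simp only [map_smul, innerPure_tprod, ← smul_add]
          congr 1
          have key : ∀ u : H i, ∏ j, inner ℂ (Function.update x i u j) (y j)
              = inner ℂ u (y i) * ∏ j ∈ Finset.univ.erase i, inner ℂ (x j) (y j) := by
            intro u
            rw [← Finset.mul_prod_erase _ _ (Finset.mem_univ i), Function.update_self]
            congr 1
            refine Finset.prod_congr rfl fun j hj => ?_
            rw [Function.update_of_ne (Finset.ne_of_mem_erase hj)]
          simp only [key, inner_add_left, add_mul]
        | ha z w hz hw => simp only [map_add, hz, hw]; ring
      map_update_smul' := by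
        intro inst x i c a
        obtain rfl : inst = instDecidableEqFin m := Subsingleton.elim _ _
        induction w using induction with
        | hs d y =>
          have key : ∀ u : H i, ∏ j, inner ℂ (Function.update x i u j) (y j)
              = inner ℂ u (y i) * ∏ j ∈ Finset.univ.erase i, inner ℂ (x j) (y j) := by
            intro u
            rw [← Finset.mul_prod_erase _ _ (Finset.mem_univ i), Function.update_self]
            congr 1
            refine Finset.prod_congr rfl fun j hj => ?_
            rw [Function.update_of_ne (Finset.ne_of_mem_erase hj)]
          simp only [map_smul, innerPure_tprod, key, inner_smul_left, smul_eq_mul, map_mul,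
            Complex.conj_conj]
          ring
        | ha z w hz hw => simp only [map_add, hz, hw, smul_add] }

theorem conjInner_tprod (w : AlgTensor H) (x : ∀ i, H i) :
    conjInner w (tprod H x) = conj (innerPure x w) :=
  PiTensorProduct.lift.tprod _

/-- The sesquilinear form with `⟨⨂ᵢ xᵢ, ⨂ᵢ yᵢ⟩ = ∏ᵢ ⟨xᵢ, yᵢ⟩`. -/
noncomputable def innerForm (z w : AlgTensor H) : ℂ :=
  conj (conjInner w z)

theorem innerForm_tprod_left (x : ∀ i, H i) (w : AlgTensor H) :
    innerForm (tprod H x) w = innerPure x w := by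
  rw [innerForm, conjInner_tprod, Complex.conj_conj]

theorem innerForm_tprod (x y : ∀ i, H i) :
    innerForm (tprod H x) (tprod H y) = ∏ i, inner ℂ (x i) (y i) := by
  rw [innerForm_tprod_left, innerPure_tprod]

theorem innerForm_add_left' (z z' w : AlgTensor H) :
    innerForm (z + z') w = innerForm z w + innerForm z' w := by
  simp [innerForm]

theorem innerForm_smul_left' (c : ℂ) (z w : AlgTensor H) :
    innerForm (c • z) w = conj c * innerForm z w := by
  simp [innerForm]

theorem innerForm_add_right' (z w w' : AlgTensor H) :
    innerForm z (w + w') = innerForm z w + innerForm z w' := by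
  induction z using induction with
  | hs c x => simp only [innerForm_smul_left', innerForm_tprod_left, map_add, mul_add]
  | ha z z' h h' => simp only [innerForm_add_left', h, h']; ring

theorem innerForm_smul_right' (c : ℂ) (z w : AlgTensor H) :
    innerForm z (c • w) = c * innerForm z w := by
  induction z using induction with
  | hs d x => simp only [innerForm_smul_left', innerForm_tprod_left, map_smul, smul_eq_mul]; ring
  | ha z z' h h' => simp only [innerForm_add_left', h, h']; ring

theorem conj_innerForm_symm (z w : AlgTensor H) : conj (innerForm w z) = innerForm z w := by
  induction z using induction with
  | hs c x =>
    induction w using induction with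
    | hs d y =>
      simp only [innerForm_smul_left', innerForm_smul_right', innerForm_tprod, map_mul, map_prod,
        inner_conj_symm, Complex.conj_conj]
      ring
    | ha w w' h h' => simp only [innerForm_add_left', innerForm_add_right', map_add, h, h']
  | ha z z' h h' => simp only [innerForm_add_left', innerForm_add_right', map_add, h, h']

/-- Every tensor is a finite combination of products of finitely many orthonormal vectors. -/
theorem exists_orthonormal_expansion (z : AlgTensor H) :
    ∃ (d : Fin m → ℕ) (e : ∀ i, Fin (d i) → H i) (c : (∀ i, Fin (d i)) → ℂ),
      (∀ i, Orthonormal ℂ (e i)) ∧ z = ∑ J, c J • tprod H (fun i => e i (J i)) := by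
  obtain ⟨k, a, x, rfl⟩ : ∃ (k : ℕ) (a : Fin k → ℂ) (x : Fin k → ∀ i, H i),
      z = ∑ l, a l • tprod H (x l) := by
    induction z using induction with
    | hs c x => exact ⟨1, fun _ => c, fun _ => x, by simp⟩
    | ha z w hz hw =>
      obtain ⟨k, a, x, rfl⟩ := hz
      obtain ⟨k', a', x', rfl⟩ := hw
      exact ⟨k + k', Fin.append a a', Fin.append x x', by simp [Fin.sum_univ_add]⟩
  let E : ∀ i, Submodule ℂ (H i) := fun i => Submodule.span ℂ (Set.range fun l => x l i)
  have hfin : ∀ i, FiniteDimensional ℂ (E i) := fun i =>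
    FiniteDimensional.span_of_finite ℂ (Set.finite_range _)
  let b : ∀ i, OrthonormalBasis (Fin (Module.finrank ℂ (E i))) ℂ (E i) :=
    fun i => stdOrthonormalBasis ℂ (E i)
  have hx : ∀ l i, x l i ∈ E i := fun l i => Submodule.subset_span ⟨l, rfl⟩
  refine ⟨fun i => Module.finrank ℂ (E i), fun i j => (b i j : H i),
    fun J => ∑ l, a l * ∏ i, (b i).repr ⟨x l i, hx l i⟩ (J i), fun i => ?_, ?_⟩
  · exact (b i).orthonormal.comp_linearIsometry (E i).subtypeₗᵢ
  · have hexp : ∀ l, tprod H (x l) = ∑ J : (∀ i, Fin (Module.finrank ℂ (E i))),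
        (∏ i, (b i).repr ⟨x l i, hx l i⟩ (J i)) • tprod H (fun i => (b i (J i) : H i)) := by
      intro l
      have h1 : x l = fun i => ∑ j, (b i).repr ⟨x l i, hx l i⟩ j • (b i j : H i) := by
        funext i
        have := congrArg (Subtype.val) ((b i).sum_repr ⟨x l i, hx l i⟩)
        simpa using this.symm
      conv_lhs => rw [h1]
      rw [MultilinearMap.map_sum]
      exact Finset.sum_congr rfl fun J _ => MultilinearMap.map_smul_univ _ _ _
    simp only [hexp, Finset.smul_sum, Finset.sum_smul, smul_smul]
    exact Finset.sum_comm

theorem innerForm_self_expansion {d : Fin m → ℕ} {e : ∀ i, Fin (d i) → H i}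
    (he : ∀ i, Orthonormal ℂ (e i)) (c : (∀ i, Fin (d i)) → ℂ) :
    innerForm (∑ J, c J • tprod H (fun i => e i (J i)))
      (∑ J, c J • tprod H (fun i => e i (J i))) = ((∑ J, ‖c J‖ ^ 2 : ℝ) : ℂ) := by
  have hl : ∀ (s : Finset (∀ i, Fin (d i))) (f : (∀ i, Fin (d i)) → AlgTensor H)
      (w : AlgTensor H), innerForm (∑ J ∈ s, f J) w = ∑ J ∈ s, innerForm (f J) w := by
    intro s f w
    simp [innerForm]
  have hr : ∀ (s : Finset (∀ i, Fin (d i))) (f : (∀ i, Fin (d i)) → AlgTensor H)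
      (w : AlgTensor H), innerForm w (∑ J ∈ s, f J) = ∑ J ∈ s, innerForm w (f J) := by
    intro s f w
    rw [← conj_innerForm_symm, hl, map_sum]
    simp only [conj_innerForm_symm]
  have horth : ∀ J K : (∀ i, Fin (d i)),
      innerForm (tprod H (fun i => e i (J i))) (tprod H (fun i => e i (K i)))
        = if J = K then (1 : ℂ) else 0 := by
    intro J K
    rw [innerForm_tprod]
    split_ifs with h
    · subst h
      exact Finset.prod_eq_one fun i _ => by
        rw [inner_self_eq_norm_sq_to_K, (he i).1]; simp
    · obtain ⟨i, hi⟩ := Function.ne_iff.mp h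
      exact Finset.prod_eq_zero (Finset.mem_univ i) ((he i).2 hi)
  rw [hl]
  simp only [hr, innerForm_smul_left', innerForm_smul_right', horth, mul_ite, mul_one, mul_zero,
    Finset.sum_ite_eq, Finset.mem_univ, if_true]
  push_cast
  exact Finset.sum_congr rfl fun J _ => by rw [mul_comm, mul_comm (conj _), Complex.mul_conj']

/-- The tensor product inner product is an inner product. -/
@[reducible]
noncomputable def innerCore : InnerProductSpace.Core ℂ (AlgTensor H) where
  inner := innerForm
  conj_inner_symm := conj_innerForm_symm
  re_inner_nonneg z := by
    obtain ⟨d, e, c, he, rfl⟩ := exists_orthonormal_expansion z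
    change 0 ≤ (innerForm _ _).re
    rw [innerForm_self_expansion he]
    exact Finset.sum_nonneg fun J _ => sq_nonneg _
  add_left := innerForm_add_left'
  smul_left z w c := innerForm_smul_left' c z w
  definite z hz := by
    obtain ⟨d, e, c, he, rfl⟩ := exists_orthonormal_expansion z
    rw [innerForm_self_expansion he, Complex.ofReal_eq_zero,
      Finset.sum_eq_zero_iff_of_nonneg fun _ _ => sq_nonneg _] at hz
    refine Finset.sum_eq_zero fun J hJ => ?_
    have := hz J hJ
    rw [sq_eq_zero_iff, norm_eq_zero] at this
    rw [this, zero_smul]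

noncomputable instance : NormedAddCommGroup (AlgTensor H) :=
  (innerCore (H := H)).toNormedAddCommGroup

noncomputable instance : InnerProductSpace ℂ (AlgTensor H) :=
  InnerProductSpace.ofCore innerCore.toCore

theorem inner_tprod (x y : ∀ i, H i) :
    inner ℂ (tprod H x) (tprod H y) = ∏ i, inner ℂ (x i) (y i) :=
  innerForm_tprod x y

end AlgTensor

variable (H) in
/-- The Hilbert space tensor product `H₁ ⊗ ⋯ ⊗ Hₘ`: the completion of the algebraic tensor
product. -/
abbrev HilbertTensor : Type _ := UniformSpace.Completion (AlgTensor H)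

namespace AlgTensor

/-- `I ⊗ ⋯ ⊗ T ⊗ ⋯ ⊗ I` with `T` in the `i`th place, on the algebraic tensor product. -/
noncomputable def localMap (i : Fin m) (T : H i →L[ℂ] H i) : AlgTensor H →ₗ[ℂ] AlgTensor H :=
  map (Function.update (fun _ => LinearMap.id) i (T : H i →ₗ[ℂ] H i))

theorem localMap_tprod (i : Fin m) (T : H i →L[ℂ] H i) (x : ∀ i, H i) :
    localMap i T (tprod H x) = tprod H (Function.update x i (T (x i))) := by
  rw [localMap, map_tprod]
  congr 1
  funext j
  by_cases h : j = i
  · subst h; simp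
  · simp [h]

theorem localMap_mul (i : Fin m) (S T : H i →L[ℂ] H i) (z : AlgTensor H) :
    localMap i (S * T) z = localMap i S (localMap i T z) := by
  induction z using induction with
  | hs c x => simp [localMap_tprod]
  | ha z z' h h' => simp only [map_add, h, h']

theorem localMap_add (i : Fin m) (S T : H i →L[ℂ] H i) (z : AlgTensor H) :
    localMap i (S + T) z = localMap i S z + localMap i T z := by
  induction z using induction with
  | hs c x => simp [localMap_tprod]
  | ha z z' h h' => simp only [map_add, h, h']; abel

theorem localMap_smul (i : Fin m) (a : ℂ) (T : H i →L[ℂ] H i) (z : AlgTensor H) :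
    localMap i (a • T) z = a • localMap i T z := by
  induction z using induction with
  | hs c x => simp [localMap_tprod, smul_comm c a]
  | ha z z' h h' => simp only [map_add, smul_add, h, h']

theorem localMap_one (i : Fin m) (z : AlgTensor H) :
    localMap i (1 : H i →L[ℂ] H i) z = z := by
  induction z using induction with
  | hs c x => simp [localMap_tprod]
  | ha z z' h h' => simp only [map_add, h, h']

theorem localMap_commute {i j : Fin m} (hij : i ≠ j) (S : H i →L[ℂ] H i) (T : H j →L[ℂ] H j)
    (z : AlgTensor H) :
    localMap i S (localMap j T z) = localMap j T (localMap i S z) := by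
  induction z using induction with
  | hs c x =>
    simp [localMap_tprod, hij, hij.symm, Function.update_comm hij]
  | ha z z' h h' => simp only [map_add, h, h']

end AlgTensor

theorem localOp_ext {S T : HilbertTensor H →L[ℂ] HilbertTensor H}
    (h : ∀ z : AlgTensor H, S (z : HilbertTensor H) = T (z : HilbertTensor H)) : S = T := by
  ext x
  induction x using UniformSpace.Completion.induction_on with
  | hp => exact isClosed_eq S.continuous T.continuous
  | ih z => exact h z

variable [∀ i, CompleteSpace (H i)]

namespace AlgTensor

theorem inner_localMap (i : Fin m) (T : H i →L[ℂ] H i) (z w : AlgTensor H) :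
    inner ℂ z (localMap i T w) = inner ℂ (localMap i (star T) z) w := by
  induction z using induction with
  | hs c x =>
    induction w using induction with
    | hs d y =>
      simp only [map_smul, localMap_tprod, inner_smul_left, inner_smul_right, inner_tprod]
      congr 2
      refine Finset.prod_congr rfl fun j _ => ?_
      by_cases h : j = i
      · subst h
        simp [ContinuousLinearMap.star_eq_adjoint, ContinuousLinearMap.adjoint_inner_left]
      · simp [h]
    | ha w w' h h' => simp only [inner_add_right, map_add, h, h']
  | ha z z' h h' => simp only [inner_add_left, map_add, h, h']

theorem norm_localMap_le (i : Fin m) (T : H i →L[ℂ] H i) (z : AlgTensor H) :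
    ‖localMap i T z‖ ≤ ‖T‖ * ‖z‖ := by
  obtain ⟨B, hB⟩ := CStarAlgebra.nonneg_iff_eq_star_mul_self.mp
    (sub_nonneg.mpr (CStarAlgebra.star_mul_le_algebraMap_norm_sq (a := T)))
  have hB' : star B * B + star T * T = ((‖T‖ ^ 2 : ℝ) : ℂ) • 1 := by
    rw [← hB, sub_add_cancel, Algebra.algebraMap_eq_smul_one]
    ext x
    simp only [smul_apply, Complex.coe_smul]
  have hsq : ∀ S : H i →L[ℂ] H i,
      inner ℂ z (localMap i (star S * S) z) = ((‖localMap i S z‖ ^ 2 : ℝ) : ℂ) := by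
    intro S
    rw [localMap_mul, inner_localMap, star_star, inner_self_eq_norm_sq_to_K]
    simp
  have h1 : inner ℂ z (localMap i (star B * B + star T * T) z)
      = (((‖localMap i B z‖ ^ 2 + ‖localMap i T z‖ ^ 2 : ℝ)) : ℂ) := by
    rw [localMap_add, inner_add_right, hsq, hsq, Complex.ofReal_add]
  rw [hB', localMap_smul, localMap_one, inner_smul_right, inner_self_eq_norm_sq_to_K] at h1
  have h2 : ‖T‖ ^ 2 * ‖z‖ ^ 2 = ‖localMap i B z‖ ^ 2 + ‖localMap i T z‖ ^ 2 := by
    have h3 : ((‖T‖ ^ 2 * ‖z‖ ^ 2 : ℝ) : ℂ)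
        = ((‖localMap i B z‖ ^ 2 + ‖localMap i T z‖ ^ 2 : ℝ) : ℂ) := by
      rw [← h1]; push_cast; rfl
    exact_mod_cast h3
  refine le_of_sq_le_sq ?_ (by positivity)
  nlinarith [sq_nonneg ‖localMap i B z‖]

end AlgTensor

/-- `I ⊗ ⋯ ⊗ T ⊗ ⋯ ⊗ I` with `T` in the `i`th place, on the Hilbert tensor product. -/
noncomputable def localOp (i : Fin m) (T : H i →L[ℂ] H i) :
    HilbertTensor H →L[ℂ] HilbertTensor H :=
  ((AlgTensor.localMap i T).mkContinuous ‖T‖ (AlgTensor.norm_localMap_le i T)).completion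

theorem localOp_coe (i : Fin m) (T : H i →L[ℂ] H i) (z : AlgTensor H) :
    localOp i T (z : HilbertTensor H) = (AlgTensor.localMap i T z : AlgTensor H) := by
  simp [localOp]

theorem localOp_mul (i : Fin m) (S T : H i →L[ℂ] H i) :
    localOp i (S * T) = localOp i S * localOp i T :=
  localOp_ext fun z => by simp [localOp_coe, AlgTensor.localMap_mul]

theorem localOp_add (i : Fin m) (S T : H i →L[ℂ] H i) :
    localOp i (S + T) = localOp i S + localOp i T :=
  localOp_ext fun z => by
    simp [localOp_coe, AlgTensor.localMap_add, UniformSpace.Completion.coe_add]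

theorem localOp_one (i : Fin m) : localOp i (1 : H i →L[ℂ] H i) = 1 :=
  localOp_ext fun z => by simp [localOp_coe, AlgTensor.localMap_one]

theorem localOp_zero (i : Fin m) : localOp i (0 : H i →L[ℂ] H i) = 0 := by
  have h := localOp_add i (0 : H i →L[ℂ] H i) 0
  rw [add_zero] at h
  exact left_eq_add.mp h

theorem localOp_sum {A : Type*} [Fintype A] (i : Fin m) (T : A → H i →L[ℂ] H i) :
    localOp i (∑ a, T a) = ∑ a, localOp i (T a) := by
  classical
  have h : ∀ s : Finset A, localOp i (∑ a ∈ s, T a) = ∑ a ∈ s, localOp i (T a) := by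
    intro s
    induction s using Finset.induction_on with
    | empty => rw [Finset.sum_empty, Finset.sum_empty, localOp_zero]
    | insert a s ha ih => rw [Finset.sum_insert ha, Finset.sum_insert ha, localOp_add, ih]
  exact h Finset.univ

theorem localOp_star (i : Fin m) (T : H i →L[ℂ] H i) :
    localOp i (star T) = star (localOp i T) := by
  rw [ContinuousLinearMap.star_eq_adjoint (localOp i T), ContinuousLinearMap.eq_adjoint_iff]
  intro x y
  induction x, y using UniformSpace.Completion.induction_on₂ with
  | hp => exact isClosed_eq (by fun_prop) (by fun_prop)
  | ih z w =>
    rw [localOp_coe, localOp_coe, UniformSpace.Completion.inner_coe,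
      UniformSpace.Completion.inner_coe, AlgTensor.inner_localMap]

theorem localOp_commute {i j : Fin m} (hij : i ≠ j) (S : H i →L[ℂ] H i) (T : H j →L[ℂ] H j) :
    Commute (localOp i S) (localOp j T) :=
  localOp_ext fun z => by simp [localOp_coe, AlgTensor.localMap_commute hij]

theorem localOp_isPositive (i : Fin m) {T : H i →L[ℂ] H i} (hT : T.IsPositive) :
    (localOp i T).IsPositive := by
  rw [← ContinuousLinearMap.nonneg_iff_isPositive] at hT ⊢
  obtain ⟨B, rfl⟩ := CStarAlgebra.nonneg_iff_eq_star_mul_self.mp hT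
  rw [localOp_mul, localOp_star]
  exact star_mul_self_nonneg _

end HilbertTensor

/-! ## Cooperative one-round games and strategies -/

universe u

/-- An `m`-player cooperative one-round game with questions in `Q` and answers in `A`: a
probability distribution on `Q^m` and a winning predicate, `V q a` meaning that the players win
with answers `a` to the questions `q`. -/
structure Game (m : ℕ) (Q A : Type) where
  questionDist : PMF (Fin m → Q)
  V : (Fin m → Q) → (Fin m → A) → Prop

open Classical in
/-- The winning probability `∑_q π(q) ∑_a S(a | q) V(a | q)` of the behavior `S`. -/
noncomputable def Game.winProb {m : ℕ} {Q A : Type} [Fintype Q] [Fintype A] (G : Game m Q A)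
    (S : (Fin m → Q) → (Fin m → A) → ℝ) : ℝ :=
  ∑ q : Fin m → Q, (G.questionDist q).toReal * ∑ a : Fin m → A, S q a * (if G.V q a then 1 else 0)

/-- An `m`-player commuting-operator strategy on the Hilbert space `H`. -/
structure CommutingOperatorStrategy (m : ℕ) (Q A : Type) [Fintype A] (H : Type*)
    [NormedAddCommGroup H] [InnerProductSpace ℂ H] [CompleteSpace H] where
  state : H →L[ℂ] H
  isDensityOperator_state : IsDensityOperator state
  meas : Fin m → Q → A → H →L[ℂ] H
  isPOVM_meas : ∀ i q, IsPOVM (meas i q)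
  commute_meas : ∀ i i', i ≠ i' → ∀ q q' a a', Commute (meas i q a) (meas i' q' a')

/-- The behavior `S(a₁,…,aₘ | q₁,…,qₘ) = tr (ρ M⁽¹⁾_{q₁,a₁} ⋯ M⁽ᵐ⁾_{qₘ,aₘ})`, a trace that is
a nonnegative real number. -/
noncomputable def CommutingOperatorStrategy.behavior {m : ℕ} {Q A : Type} [Fintype A] {H : Type*}
    [NormedAddCommGroup H] [InnerProductSpace ℂ H] [CompleteSpace H]
    (S : CommutingOperatorStrategy m Q A H) (q : Fin m → Q) (a : Fin m → A) : ℝ :=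
  (opTrace (S.state * (List.ofFn fun i => S.meas i (q i) (a i)).prod)).re

/-- An `m`-player entangled strategy: the players share a state on `H₁ ⊗ ⋯ ⊗ Hₘ`, and the `i`th
player measures the `i`th tensor factor `Hᵢ`. -/
structure EntangledStrategy (m : ℕ) (Q A : Type) [Fintype A] (H : Fin m → Type*)
    [∀ i, NormedAddCommGroup (H i)] [∀ i, InnerProductSpace ℂ (H i)]
    [∀ i, CompleteSpace (H i)] where
  state : HilbertTensor H →L[ℂ] HilbertTensor H
  isDensityOperator_state : IsDensityOperator state
  meas : ∀ i : Fin m, Q → A → H i →L[ℂ] H i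
  isPOVM_meas : ∀ i q, IsPOVM (meas i q)

/-- An entangled strategy viewed as a commuting-operator strategy on `H₁ ⊗ ⋯ ⊗ Hₘ`. -/
noncomputable def EntangledStrategy.toCommuting {m : ℕ} {Q A : Type} [Fintype A]
    {H : Fin m → Type*} [∀ i, NormedAddCommGroup (H i)] [∀ i, InnerProductSpace ℂ (H i)]
    [∀ i, CompleteSpace (H i)] (S : EntangledStrategy m Q A H) :
    CommutingOperatorStrategy m Q A (HilbertTensor H) where
  state := S.state
  isDensityOperator_state := S.isDensityOperator_state
  meas i q a := localOp i (S.meas i q a)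
  isPOVM_meas i q :=
    ⟨fun a => localOp_isPositive i ((S.isPOVM_meas i q).isPositive a), by
      rw [← localOp_sum, (S.isPOVM_meas i q).sum_eq_one, localOp_one]⟩
  commute_meas _ _ h _ _ _ _ := localOp_commute h _ _

/-- The winning probabilities in `G` of all commuting-operator strategies. -/
def Game.commutingWinProbs {m : ℕ} {Q A : Type} [Fintype Q] [Fintype A] (G : Game m Q A) :
    Set ℝ :=
  {w | ∃ (H : Type u) (_ : NormedAddCommGroup H) (_ : InnerProductSpace ℂ H)
    (_ : CompleteSpace H) (S : CommutingOperatorStrategy m Q A H), w = G.winProb S.behavior}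

/-- The winning probabilities in `G` of all entangled strategies. -/
def Game.entangledWinProbs {m : ℕ} {Q A : Type} [Fintype Q] [Fintype A] (G : Game m Q A) :
    Set ℝ :=
  {w | ∃ (H : Fin m → Type u) (_ : ∀ i, NormedAddCommGroup (H i))
    (_ : ∀ i, InnerProductSpace ℂ (H i)) (_ : ∀ i, CompleteSpace (H i))
    (S : EntangledStrategy m Q A H), w = G.winProb S.toCommuting.behavior}

/-- The winning probabilities in `G` of all entangled strategies in which the space of every
player is finite-dimensional. -/
def Game.finDimEntangledWinProbs {m : ℕ} {Q A : Type} [Fintype Q] [Fintype A]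
    (G : Game m Q A) : Set ℝ :=
  {w | ∃ (H : Fin m → Type u) (_ : ∀ i, NormedAddCommGroup (H i))
    (_ : ∀ i, InnerProductSpace ℂ (H i)) (_ : ∀ i, CompleteSpace (H i))
    (_ : ∀ i, FiniteDimensional ℂ (H i))
    (S : EntangledStrategy m Q A H), w = G.winProb S.toCommuting.behavior}

/-! ## The Magic Square game -/

/-- The `l`th cell of a line of the `n × n` square: `Sum.inl j` is row `j`, `Sum.inr k` is
column `k`. A cell is a pair (row, column). -/
def lineCell {n : ℕ} : Fin n ⊕ Fin n → Fin n → Fin n × Fin n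
  | Sum.inl j, l => (j, l)
  | Sum.inr k, l => (l, k)

/-- The `n`-player Magic Square game. The referee chooses uniformly one of the `n` rows and `n`
columns, and independently a uniformly random assignment `σ` of its `n` cells to the players, and
asks each player for the content of the assigned cell. The players win iff the sum of their
answers is even, except that it has to be odd if all the cells are in the last column. -/
noncomputable def magicSquareGame (n : ℕ) [NeZero n] : Game n (Fin n × Fin n) (Fin 2) where
  questionDist :=
    (PMF.uniformOfFintype (Fin n ⊕ Fin n)).bind fun line =>
      (PMF.uniformOfFintype (Equiv.Perm (Fin n))).map fun σ i => lineCell line (σ i)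
  V q a :=
    if ∀ i, (q i).2.val + 1 = n then Odd (∑ i, (a i).val) else Even (∑ i, (a i).val)

/-! With answers read as signs, the winning probability is `(1 + E) / 2`, where `E` averages the
signed expectation of the product of the players' observables `A = M 0 - M 1`
(`winProb_magicSquareGame`).

Upper bound. Give each player a symbol of the Latin square `j + k`, according to a random
permutation `τ`. On each single line this is the referee's random assignment (`sum_perm_lineCell`),
so it suffices to bound the sum over all lines for fixed `τ`. Each cell of a player then lies on one
row and one column. Every `A` is the average of a unitary and its inverse
(`exists_unitary_average`), and the unitary may be used in the row and the inverse in the column.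
With rows and columns in alternation, a player's word of `2n` unitaries splits into two blocks, each
cancelling from its middle outwards, so the word is `1`. As different players commute, the partial
products over the lines carry a unit vector `ψ` around a closed chain; the sign of the last column
turns its end into `-ψ`. A chain of `2n` unit vectors from `ψ` to `-ψ` has consecutive real inner
products averaging at most `cos (π / (2n))` (`sum_re_inner_le_of_antiperiodic`). Square roots of
density operators reduce mixed states to vectors.

Lower bound. For a GHZ state and equatorial measurements the correlation is the cosine of the sum of
the angles, and `magicSquareAngle` makes every line contribute exactly `cos (π / (2n))`. The
strategy is finite-dimensional, and the bound holds for commuting operators, so the two settle all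
three suprema. -/

/-! ### Binary observables as averages of unitaries -/

/-- A self-adjoint contraction `A` is the mean of the unitaries `A ± i √(1 - A²)`. Being functions
of `A`, these inherit every commutation relation of the POVM, so no dilation to projective
measurements is needed. -/
theorem exists_unitary_average {H : Type*} [NormedAddCommGroup H] [InnerProductSpace ℂ H]
    [CompleteSpace H] {M : Fin 2 → H →L[ℂ] H} (hM : IsPOVM M) :
    ∃ V : Fin 2 → H →L[ℂ] H, V 0 * V 1 = 1 ∧ V 1 * V 0 = 1 ∧ (∀ e, star (V e) = V (1 - e)) ∧
      (∑ e, (2⁻¹ : ℂ) • V e) = M 0 - M 1 ∧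
      ∀ B, Commute (M 0) B → Commute (M 1) B → ∀ e, Commute (V e) B := by
  have h0 : (0 : H →L[ℂ] H) ≤ M 0 :=
    (ContinuousLinearMap.nonneg_iff_isPositive _).2 (hM.isPositive 0)
  have h1 : (0 : H →L[ℂ] H) ≤ M 1 :=
    (ContinuousLinearMap.nonneg_iff_isPositive _).2 (hM.isPositive 1)
  have hs : M 0 + M 1 = 1 := by simpa using hM.sum_eq_one
  set A : H →L[ℂ] H := M 0 - M 1 with hA
  have hsa : IsSelfAdjoint A := (IsSelfAdjoint.of_nonneg h0).sub (IsSelfAdjoint.of_nonneg h1)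
  have hn : ‖A‖ ≤ 1 := by
    have hc : Commute (M 0) (M 1) := by
      rw [← eq_sub_iff_add_eq'] at hs
      rw [hs]
      exact (Commute.one_right _).sub_right (Commute.refl _)
    have hsq : A ^ 2 ≤ 1 := by
      -- `(x + y)² - (x - y)² = 4xy` for commuting `x`, `y`; a product of commuting positive
      -- operators is positive.
      have h4 : (1 : H →L[ℂ] H) - A ^ 2 = (4 : ℝ) • (M 0 * M 1) := by
        have : (1 : H →L[ℂ] H) = (M 0 + M 1) ^ 2 := by rw [hs, one_pow]
        rw [this, hA, pow_two, pow_two, show (4 : ℝ) = 1 + 1 + 1 + 1 by norm_num]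
        simp only [add_smul, one_smul, mul_add, add_mul, mul_sub, sub_mul, hc.eq]
        abel
      rw [← sub_nonneg, h4]
      exact smul_nonneg (by norm_num) (hc.mul_nonneg h0 h1)
    have h2 := (CStarAlgebra.norm_le_one_iff_of_nonneg (A ^ 2) (by
      rw [pow_two]; nth_rw 1 [← hsa.star_eq]; exact star_mul_self_nonneg A)).2 hsq
    rwa [sq, hsa.norm_mul_self, sq_le_one_iff₀ (norm_nonneg _)] at h2
  set S : H →L[ℂ] H := CFC.sqrt (1 - A ^ 2) with hS
  have hU := hsa.self_add_I_smul_cfcSqrt_sub_sq_mem_unitary A hn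
  have hSs : star S = S := (IsSelfAdjoint.of_nonneg (CFC.sqrt_nonneg _)).star_eq
  have hst : star (A + Complex.I • S) = A - Complex.I • S := by
    rw [star_add, star_smul, hsa.star_eq, hSs]; simp [sub_eq_add_neg]
  have hu := Unitary.mem_iff.1 hU
  rw [hst] at hu
  refine ⟨![A + Complex.I • S, A - Complex.I • S], hu.2, hu.1, ?_, ?_, ?_⟩
  · intro e
    fin_cases e
    · exact hst
    · simpa using (congrArg star hst).symm
  · simp only [Fin.sum_univ_two, Matrix.cons_val_zero, Matrix.cons_val_one]
    rw [← smul_add, add_add_sub_cancel, ← two_smul ℂ A, smul_smul]; norm_num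
  · intro B c0 c1 e
    have cA : Commute A B := c0.sub_left c1
    have cS : Commute S B := by
      rw [hS, CFC.sqrt_eq_cfc]
      exact ((Commute.one_left B).sub_left (cA.pow_left 2)).cfc_nnreal _
    fin_cases e
    · exact cA.add_left (cS.smul_left _)
    · exact cA.sub_left (cS.smul_left _)

/-- Each `g i` has to pass only factors `f j` with `j ≠ i`. This regroups a product over lines of
products over players into one word per player. -/
theorem List.prod_ofFn_mul_prod_ofFn {R : Type*} [Monoid R] :
    ∀ {n : ℕ} (f g : Fin n → R), (∀ i j, i ≠ j → Commute (f i) (g j)) →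
      (List.ofFn f).prod * (List.ofFn g).prod = (List.ofFn fun i => f i * g i).prod
  | 0, f, g, _ => by simp
  | n + 1, f, g, h => by
    have ih := List.prod_ofFn_mul_prod_ofFn (fun i => f (Fin.succ i)) (fun i => g (Fin.succ i))
      fun i j hij => h _ _ (by simpa using hij)
    have hc : Commute (g 0) (List.ofFn fun i : Fin n => f i.succ).prod := by
      refine Commute.list_prod_right _ _ fun x hx => ?_
      obtain ⟨i, rfl⟩ := (List.mem_ofFn' _ _).1 hx
      exact (h _ _ (Fin.succ_ne_zero i)).symm
    simp only [List.ofFn_succ, List.prod_cons]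
    rw [← ih, mul_assoc, ← mul_assoc _ (g 0), ← hc.eq]
    simp only [mul_assoc]

theorem List.star_prod_ofFn_mul_self {R : Type*} [Monoid R] [StarMul R] {n : ℕ} (f : Fin n → R)
    (hf : ∀ i, star (f i) * f i = 1) : star (List.ofFn f).prod * (List.ofFn f).prod = 1 := by
  induction n with
  | zero => simp
  | succ n ih =>
    simp only [List.ofFn_succ, List.prod_cons, star_mul]
    rw [mul_assoc, ← mul_assoc _ (f 0), hf, one_mul, ih _ fun i => hf _]

/-! ### The inequality for antiperiodic chains -/

open Real in
/-- A closed chain of vectors that changes its sign once around. -/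
theorem sum_re_inner_le_of_antiperiodic {E : Type*} [NormedAddCommGroup E]
    [InnerProductSpace ℂ E] {N : ℕ} (hN : 2 ≤ N) (v : ℕ → E) (hv : v N = -v 0) :
    ∑ k ∈ Finset.range N, (inner ℂ (v k) (v (k + 1))).re
      ≤ cos (π / N) * ∑ k ∈ Finset.range N, ‖v k‖ ^ 2 := by
  set α := π / N with hα
  have hN0 : (0 : ℝ) < N := by positivity
  have hNα : N * α = π := by rw [hα]; field_simp
  have hα0 : 0 < α := by positivity
  have hsin : ∀ k : ℕ, 1 ≤ k → k < N → 0 < sin (k * α) := fun k h1 h2 => by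
    have h1' : (1 : ℝ) ≤ k := by exact_mod_cast h1
    have h2' : (k : ℝ) < N := by exact_mod_cast h2
    exact sin_pos_of_pos_of_lt_pi (by positivity) (by rw [← hNα]; gcongr)
  -- The first `k` links are bounded below in terms of the end vectors `v 0` and `v k` alone,
  -- eliminating the vectors between them one at a time.
  have key : ∀ k : ℕ, 1 ≤ k → k < N →
      sin α / sin (k * α) * (cos (k * α) * (‖v 0‖ ^ 2 + ‖v k‖ ^ 2) - 2 * (inner ℂ (v 0) (v k)).re)
      ≤ ∑ j ∈ Finset.range k, (cos α * (‖v j‖ ^ 2 + ‖v (j + 1)‖ ^ 2)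
          - 2 * (inner ℂ (v j) (v (j + 1))).re) := by
    intro k h1
    induction k, h1 using Nat.le_induction with
    | base =>
      intro h
      have := hsin 1 le_rfl h
      simp only [Nat.cast_one, one_mul] at this
      simp [div_self this.ne']
    | succ k h1 ih =>
      intro h
      rw [Finset.sum_range_succ]
      have hs := hsin k h1 (by omega)
      have hS := hsin (k + 1) (by omega) h
      refine le_trans ?_ (add_le_add_left (ih (by omega)) _)
      have hd : ((k + 1 : ℕ) : ℝ) * α = k * α + α := by push_cast; ring
      rw [hd] at hS ⊢
      -- This vector vanishes when the chain rotates in a plane by the angle `α` per step, the case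
      -- of equality. Its squared norm over `sin (kα) sin ((k+1)α)` is exactly the slack of the
      -- induction step.
      have hsq := sq_nonneg ‖(sin (k * α + α) : ℂ) • v k - (sin α : ℂ) • v 0
        - (sin (k * α) : ℂ) • v (k + 1)‖
      have hexp : ‖(sin (k * α + α) : ℂ) • v k - (sin α : ℂ) • v 0
        - (sin (k * α) : ℂ) • v (k + 1)‖ ^ 2 = sin (k * α + α) ^ 2 * ‖v k‖ ^ 2
          + sin α ^ 2 * ‖v 0‖ ^ 2 + sin (k * α) ^ 2 * ‖v (k + 1)‖ ^ 2
          - 2 * sin (k * α + α) * sin α * (inner ℂ (v 0) (v k)).re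
          - 2 * sin (k * α + α) * sin (k * α) * (inner ℂ (v k) (v (k + 1))).re
          + 2 * sin α * sin (k * α) * (inner ℂ (v 0) (v (k + 1))).re := by
        rw [@norm_sub_sq ℂ, @norm_sub_sq ℂ, inner_sub_left]
        simp only [inner_smul_left, inner_smul_right, norm_smul, Complex.conj_ofReal, map_sub,
          RCLike.re_to_complex, Complex.re_ofReal_mul, Complex.norm_real, mul_pow, norm_eq_abs,
          sq_abs]
        rw [← inner_conj_symm (v k) (v 0), Complex.conj_re]
        ring
      rw [hexp] at hsq
      have hpos : 0 < sin (k * α) * sin (k * α + α) := mul_pos hs hS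
      have hq := div_nonneg hsq hpos.le
      rw [← sub_nonneg]
      refine hq.trans_eq ?_
      rw [div_eq_iff hpos.ne']
      have e1 : sin (k * α + α) = sin (k * α) * cos α + cos (k * α) * sin α := sin_add _ _
      have e2 : cos (k * α + α) = cos (k * α) * cos α - sin (k * α) * sin α := cos_add _ _
      have e3 := sin_sq_add_cos_sq (k * α)
      have e4 := sin_sq_add_cos_sq α
      rw [e1] at hS
      rw [e1, e2]
      generalize sin (k * α) = s at *
      generalize cos (k * α) = c at *
      generalize sin α = t at *
      generalize cos α = d at *
      have hS' : s * d + c * t ≠ 0 := hS.ne'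
      have hs' : s ≠ 0 := hs.ne'
      field_simp
      linear_combination (-(t ^ 2) * ‖v 0‖ ^ 2) * e3 - (s ^ 2 * ‖v (k + 1)‖ ^ 2) * e4
  -- At `k = N - 1` the quotient of sines is `1` and the cosine is `-cos α`, so the bound cancels
  -- against the closing link from `v (N - 1)` to `-v 0`.
  have hlast := key (N - 1) (by omega) (by omega)
  have hcast : ((N - 1 : ℕ) : ℝ) * α = π - α := by
    rw [Nat.cast_sub (by omega), sub_mul, hNα]; simp
  have hsα : 0 < sin α := by simpa using hsin 1 le_rfl (by omega)
  rw [hcast, sin_pi_sub, cos_pi_sub, div_self hsα.ne', one_mul] at hlast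
  obtain ⟨m, rfl⟩ : ∃ m, N = m + 1 := ⟨N - 1, by omega⟩
  simp only [Nat.add_sub_cancel] at hlast
  have htot : ∑ j ∈ Finset.range (m + 1), (cos α * (‖v j‖ ^ 2 + ‖v (j + 1)‖ ^ 2)
          - 2 * (inner ℂ (v j) (v (j + 1))).re) ≥ 0 := by
    rw [Finset.sum_range_succ, hv]
    have : (inner ℂ (v m) (-v 0)).re = -(inner ℂ (v 0) (v m)).re := by
      rw [inner_neg_right, Complex.neg_re, ← inner_conj_symm, Complex.conj_re]
    rw [this, norm_neg]
    linarith
  have hshift : ∑ j ∈ Finset.range (m + 1), ‖v (j + 1)‖ ^ 2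
      = ∑ j ∈ Finset.range (m + 1), ‖v j‖ ^ 2 := by
    rw [Finset.sum_range_succ, hv, norm_neg, Finset.sum_range_succ']
  rw [Finset.sum_sub_distrib, ← Finset.mul_sum, ← Finset.mul_sum, Finset.sum_add_distrib,
    hshift] at htot
  linarith

/-! ### Density operators as sums of vector states -/

section Trace

theorem HilbertBasis.hasSum_sq_norm_inner {ι H : Type*} [NormedAddCommGroup H]
    [InnerProductSpace ℂ H] (b : HilbertBasis ι ℂ H) (x : H) :
    HasSum (fun i => ‖(inner ℂ x (b i) : ℂ)‖ ^ 2) (‖x‖ ^ 2) := by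
  have h := Complex.hasSum_re (b.hasSum_inner_mul_inner x x)
  rw [inner_self_eq_norm_sq_to_K] at h
  convert h using 1
  · funext i
    rw [← inner_conj_symm (b i) x, Complex.mul_conj']
    norm_cast
  · norm_cast

theorem HilbertBasis.summable_sq_norm_inner {ι κ H : Type*} [NormedAddCommGroup H]
    [InnerProductSpace ℂ H] (b : HilbertBasis ι ℂ H) {y : κ → H}
    (hy : Summable fun k => ‖y k‖ ^ 2) :
    Summable fun p : κ × ι => ‖(inner ℂ (y p.1) (b p.2) : ℂ)‖ ^ 2 := by
  rw [summable_prod_of_nonneg (Pi.le_def.2 fun p => sq_nonneg ‖(inner ℂ (y p.1) (b p.2) : ℂ)‖)]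
  refine ⟨fun k => (b.hasSum_sq_norm_inner (y k)).summable, ?_⟩
  simpa only [(b.hasSum_sq_norm_inner _).tsum_eq] using hy

variable {H : Type*} [NormedAddCommGroup H] [InnerProductSpace ℂ H] [CompleteSpace H]

/-- The vectors are `√ρ` applied to the basis, and the formula is cyclicity of the trace, `tr (√ρ √ρ
T) = tr (√ρ T √ρ)`. It turns bounds on quadratic forms into bounds on `opTrace`. -/
theorem IsDensityOperator.exists_hasSum {ρ : H →L[ℂ] H} (hρ : IsDensityOperator ρ) :
    ∃ x : stdHilbertIndex H → H, HasSum (fun e => ‖x e‖ ^ 2) 1 ∧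
      ∀ T : H →L[ℂ] H, HasSum (fun e => inner ℂ (x e) (T (x e))) (opTrace (ρ * T)) := by
  have h0 : 0 ≤ ρ := (ContinuousLinearMap.nonneg_iff_isPositive _).2 hρ.isPositive
  set R : H →L[ℂ] H := CFC.sqrt ρ with hR
  have hRR : R * R = ρ := CFC.sqrt_mul_sqrt_self ρ
  have hRs : star R = R := (IsSelfAdjoint.of_nonneg (CFC.sqrt_nonneg ρ)).star_eq
  have hRi : ∀ x y : H, inner ℂ (R x) y = inner ℂ x (R y) := fun x y => by
    nth_rw 1 [← hRs]
    rw [ContinuousLinearMap.star_eq_adjoint, ContinuousLinearMap.adjoint_inner_left]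
  set b := stdHilbertBasis H
  have hx : HasSum (fun e => ‖R (b e)‖ ^ 2) 1 := by
    have h := Complex.hasSum_re hρ.hasSum_trace
    rw [Complex.one_re] at h
    convert h using 1
    funext e
    rw [← hRR]
    change _ = (inner ℂ (b e) (R (R (b e)))).re
    rw [← hRi, inner_self_eq_norm_sq_to_K]
    norm_cast
  refine ⟨fun e => R (b e), hx, fun T => ?_⟩
  have hT : ∀ x y : H, inner ℂ x (T y) = inner ℂ (star T x) y := fun x y => by
    rw [ContinuousLinearMap.star_eq_adjoint, ContinuousLinearMap.adjoint_inner_left]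
  -- Summing this double series over `p.2` first gives the terms of `opTrace (ρ * T)`, over `p.1`
  -- first those of the vector states. The exchange is legitimate because each entry is a product of
  -- two square-summable ones.
  let g : stdHilbertIndex H × stdHilbertIndex H → ℂ := fun p =>
    inner ℂ (R (b p.1)) (b p.2) * inner ℂ (b p.2) (R (T (b p.1)))
  have hg2 : ∀ e f, inner ℂ (b f) (R (T (b e))) = inner ℂ (star T (R (b f))) (b e) := fun e f => by
    rw [← hRi, hT]
  have s1 := b.summable_sq_norm_inner hx.summable
  have s2 := b.summable_sq_norm_inner (y := fun f => star T (R (b f))) <| by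
    refine Summable.of_nonneg_of_le (fun e => sq_nonneg _) (fun e => ?_)
      (hx.summable.mul_left (‖star T‖ ^ 2))
    rw [← mul_pow]
    gcongr
    exact ContinuousLinearMap.le_opNorm _ _
  have hgs : Summable g := by
    refine Summable.of_norm_bounded (s1.add ((Equiv.prodComm _ _).summable_iff.2 s2)) fun p => ?_
    simp only [g, hg2, norm_mul, Function.comp, Equiv.prodComm_apply, Prod.fst_swap, Prod.snd_swap]
    nlinarith [sq_nonneg (‖(inner ℂ (R (b p.1)) (b p.2) : ℂ)‖
      - ‖(inner ℂ (star T (R (b p.2))) (b p.1) : ℂ)‖),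
      sq_nonneg ‖(inner ℂ (R (b p.1)) (b p.2) : ℂ)‖,
      sq_nonneg ‖(inner ℂ (star T (R (b p.2))) (b p.1) : ℂ)‖]
  have hsum := hgs.hasSum
  have h1 := hsum.prod_fiberwise (fun e => b.hasSum_inner_mul_inner (R (b e)) (R (T (b e))))
  have h2 := ((Equiv.prodComm _ _).hasSum_iff.2 hsum).prod_fiberwise
    (g := fun f => inner ℂ (R (b f)) (T (R (b f)))) (fun f => by
      have := b.hasSum_inner_mul_inner (star T (R (b f))) (R (b f))
      rw [← hT] at this
      have hg : (fun e => inner ℂ (star T (R (b f))) (b e) * inner ℂ (b e) (R (b f)))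
          = fun e => (g ∘ Equiv.prodComm _ _) (f, e) := funext fun e => by
        simp only [g, Function.comp, Equiv.prodComm_apply, Prod.swap_prod_mk, hg2, hRi]
        ring
      rw [hg] at this
      exact this)
  have h3 : opTrace (ρ * T) = ∑' p, g p := by
    rw [← h1.tsum_eq, opTrace]
    refine tsum_congr fun e => ?_
    rw [hRi, ← hRR]
    rfl
  rw [h3]
  exact h2

theorem IsDensityOperator.opTrace_eq_one {ρ : H →L[ℂ] H} (hρ : IsDensityOperator ρ) :
    opTrace ρ = 1 :=
  hρ.hasSum_trace.tsum_eq

theorem IsDensityOperator.opTrace_mul_sum {ρ : H →L[ℂ] H} (hρ : IsDensityOperator ρ)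
    {ι : Type*} (s : Finset ι) (c : ι → ℂ) (T : ι → H →L[ℂ] H) :
    opTrace (ρ * ∑ i ∈ s, c i • T i) = ∑ i ∈ s, c i * opTrace (ρ * T i) := by
  obtain ⟨x, -, hx⟩ := hρ.exists_hasSum
  refine (hx _).unique ?_
  simpa only [sum_apply, smul_apply, inner_sum,
    inner_smul_right] using hasSum_sum fun i (_ : i ∈ s) => (hx (T i)).mul_left (c i)

theorem IsDensityOperator.re_opTrace_mul_le {ρ : H →L[ℂ] H} (hρ : IsDensityOperator ρ)
    {T : H →L[ℂ] H} {C : ℝ} (hT : ∀ ψ : H, (inner ℂ ψ (T ψ)).re ≤ C * ‖ψ‖ ^ 2) :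
    (opTrace (ρ * T)).re ≤ C := by
  obtain ⟨x, h1, hx⟩ := hρ.exists_hasSum
  simpa using hasSum_le (fun e => hT (x e)) (Complex.hasSum_re (hx T)) (h1.mul_left C)

end Trace

/-! ### Words that cancel by reflection, and the bound for unitaries -/

theorem List.prod_map_range_reflect {R : Type*} [Monoid R] (w : ℕ → R) (m : ℕ) :
    ∀ T : ℕ, T ≤ m → (∀ t < T, w (m - 1 - t) * w (m + t) = 1) →
      ((List.range (m + T)).map w).prod = ((List.range (m - T)).map w).prod
  | 0, _, _ => rfl
  | T + 1, hT, h => by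
    have ih := List.prod_map_range_reflect w m T (by omega) fun t ht => h t (by omega)
    have e : m - T = (m - (T + 1)) + 1 := by omega
    rw [← add_assoc, List.prod_range_succ, ih, e, List.prod_range_succ, mul_assoc]
    have := h T (by omega)
    rw [show m - 1 - T = m - (T + 1) by omega] at this
    rw [this, mul_one]

/-- The word splits into the positions `0, …, 2c + 1` and `2c + 2, …, 2n - 1`. Each block is
reflected onto itself by one of the two conditions on `a + b`, and cancels from its middle outwards.
-/
theorem List.prod_map_range_eq_one_of_reflect {R : Type*} [Monoid R] {n c : ℕ} (hc : c < n)
    (w : ℕ → R) (h : ∀ a b, (a + b = 2 * c + 1 ∨ a + b = 2 * c + 1 + 2 * n) → w a * w b = 1) :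
    ((List.range (2 * n)).map w).prod = 1 := by
  have h1 := List.prod_map_range_reflect w (c + 1) (c + 1) le_rfl
    fun t ht => h _ _ (Or.inl (by omega))
  have h2 := List.prod_map_range_reflect w (c + 1 + n) (n - 1 - c) (by omega)
    fun t ht => h _ _ (Or.inr (by omega))
  rw [show c + 1 + n + (n - 1 - c) = 2 * n by omega,
    show c + 1 + n - (n - 1 - c) = c + 1 + (c + 1) by omega, h1] at h2
  simpa using h2

section Words

variable {H : Type*} [NormedAddCommGroup H] [InnerProductSpace ℂ H] [CompleteSpace H]

/-- The partial products `P a` preserve inner products, so the term at `a` is the inner product of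
`P a ψ` and `P (a + 1) ψ`. All players' words collapse, so `P (2 * n) = 1` and the chain closes up.
-/
theorem sum_re_inner_prod_le {n : ℕ} (hn : 1 ≤ n) (c : Fin n → Fin n)
    (u : Fin n → ℕ → H →L[ℂ] H)
    (hcomm : ∀ i j, i ≠ j → ∀ a b, Commute (u i a) (u j b))
    (hunit : ∀ i a, star (u i a) * u i a = 1)
    (hpair : ∀ i a b, (a + b = 2 * (c i : ℕ) + 1 ∨ a + b = 2 * (c i : ℕ) + 1 + 2 * n) →
      u i a * u i b = 1) (ψ : H) :
    ∑ a ∈ Finset.range (2 * n), (if a + 1 = 2 * n then -1 else 1 : ℝ) *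
        (inner ℂ ψ ((List.ofFn fun i => u i a).prod ψ)).re
      ≤ 2 * n * Real.cos (Real.pi / (2 * n)) * ‖ψ‖ ^ 2 := by
  let p : Fin n → ℕ → H →L[ℂ] H := fun i a => ((List.range a).map (u i)).prod
  let P : ℕ → H →L[ℂ] H := fun a => (List.ofFn fun i => p i a).prod
  have hpc : ∀ i j, i ≠ j → ∀ a b, Commute (p i a) (u j b) := fun i j hij a b => by
    refine Commute.list_prod_left _ _ fun x hx => ?_
    obtain ⟨k, -, rfl⟩ := List.mem_map.1 hx
    exact hcomm i j hij k b
  have hP : ∀ a, P (a + 1) = P a * (List.ofFn fun i => u i a).prod := fun a => by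
    rw [List.prod_ofFn_mul_prod_ofFn _ _ fun i j hij => hpc i j hij a a]
    simp only [P, p, List.prod_range_succ]
  have hpu : ∀ i a, star (p i a) * p i a = 1 := fun i a => by
    induction a with
    | zero => simp [p]
    | succ a ih =>
      have : p i (a + 1) = p i a * u i a := List.prod_range_succ _ _
      rw [this, star_mul, mul_assoc, ← mul_assoc _ (p i a), ih, one_mul, hunit]
  have hPu : ∀ a x y, inner ℂ (P a x) (P a y) = inner ℂ x y := fun a x y => by
    rw [← ContinuousLinearMap.adjoint_inner_right, ← ContinuousLinearMap.star_eq_adjoint,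
      ← mul_apply_eq_comp, List.star_prod_ofFn_mul_self _ fun i => hpu i a,
      one_apply_eq_self]
  have hPend : P (2 * n) = 1 := by
    have : ∀ i, p i (2 * n) = 1 := fun i =>
      List.prod_map_range_eq_one_of_reflect (c i).2 _ (hpair i)
    simp [P, this]
  have hP0 : P 0 = 1 := by simp [P, p]
  -- Ending at `-ψ` instead of `P (2 * n) ψ = ψ` absorbs the sign of the last line and makes the
  -- chain antiperiodic.
  let v : ℕ → H := fun a => if a = 2 * n then -ψ else P a ψ
  have hv0 : v 0 = ψ := by
    simp only [v, hP0]
    rw [if_neg (by omega)]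
    rfl
  have hmain := sum_re_inner_le_of_antiperiodic (N := 2 * n) (by omega) v (by rw [hv0]; simp [v])
  have hnorm : ∀ a ∈ Finset.range (2 * n), ‖v a‖ ^ 2 = ‖ψ‖ ^ 2 := fun a ha => by
    have ha : a < 2 * n := Finset.mem_range.1 ha
    have h := hPu a ψ ψ
    simp only [inner_self_eq_norm_sq_to_K] at h
    simp only [v, if_neg ha.ne]
    exact_mod_cast h
  rw [Finset.sum_congr rfl hnorm, Finset.sum_const, Finset.card_range, nsmul_eq_mul] at hmain
  push_cast at hmain
  refine (le_of_eq (Finset.sum_congr rfl fun a ha => ?_)).trans (hmain.trans_eq (by ring))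
  have ha : a < 2 * n := Finset.mem_range.1 ha
  have h := hPu a ψ ((List.ofFn fun i => u i a).prod ψ)
  rw [← mul_apply_eq_comp, ← hP] at h
  simp only [v, if_neg ha.ne]
  rw [← h]
  split_ifs with h1
  · rw [h1, hPend]; simp
  · simp

end Words

/-! ### The winning probability in terms of correlations -/

theorem List.prod_ofFn_eq_average {R : Type*} [Ring R] [Algebra ℂ R] {n : ℕ} (A : Fin n → R)
    (g : Fin n → Fin 2 → R) (h : ∀ i, ∑ e, (2⁻¹ : ℂ) • g i e = A i) :
    (List.ofFn A).prod
      = ∑ ε : Fin n → Fin 2, ((2⁻¹ : ℂ) ^ n) • (List.ofFn fun i => g i (ε i)).prod := by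
  have := (MultilinearMap.mkPiAlgebraFin ℂ n R).map_sum (fun i e => (2⁻¹ : ℂ) • g i e)
  simp only [h, MultilinearMap.map_smul_univ] at this
  simpa using this

theorem PMF.sum_bind_toReal_mul {α β : Type*} [Fintype α] [Fintype β] (p : PMF α)
    (f : α → PMF β) (F : β → ℝ) :
    ∑ b, ((p.bind f) b).toReal * F b = ∑ a, (p a).toReal * ∑ b, (f a b).toReal * F b := by
  have h : ∀ b, ((p.bind f) b).toReal = ∑ a, (p a).toReal * (f a b).toReal := fun b => by
    rw [PMF.bind_apply, tsum_fintype, ENNReal.toReal_sum fun a _ =>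
      ENNReal.mul_ne_top (p.apply_ne_top a) ((f a).apply_ne_top b)]
    simp only [ENNReal.toReal_mul]
  simp only [h, Finset.sum_mul, Finset.mul_sum, mul_assoc]
  exact Finset.sum_comm

theorem PMF.sum_map_toReal_mul {α β : Type*} [Fintype α] [Fintype β] (p : PMF α)
    (f : α → β) (F : β → ℝ) :
    ∑ b, ((p.map f) b).toReal * F b = ∑ a, (p a).toReal * F (f a) := by
  classical
  rw [← PMF.bind_pure_comp, PMF.sum_bind_toReal_mul]
  refine Finset.sum_congr rfl fun a _ => ?_
  congr 1
  simp [PMF.pure_apply, apply_ite ENNReal.toReal]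

/-- `-1` for the last column and `1` for every other line. -/
def lineSign (n : ℕ) : Fin n ⊕ Fin n → ℝ
  | Sum.inl _ => 1
  | Sum.inr k => if k.val + 1 = n then -1 else 1

theorem magicSquareGame_V_lineCell {n : ℕ} [NeZero n] (hn : 2 ≤ n) (line : Fin n ⊕ Fin n)
    (σ : Equiv.Perm (Fin n)) (a : Fin n → Fin 2) [Decidable
      ((magicSquareGame n).V (fun i => lineCell line (σ i)) a)] :
    (if (magicSquareGame n).V (fun i => lineCell line (σ i)) a then 1 else 0 : ℝ)
      = (1 + lineSign n line * ∏ i, (-1) ^ (a i).val) / 2 := by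
  have hV : (magicSquareGame n).V (fun i => lineCell line (σ i)) a ↔
      if lineSign n line = -1 then Odd (∑ i, (a i).val) else Even (∑ i, (a i).val) := by
    rcases line with j | k
    -- Some player is asked the cell of the row in column `0`, which is not the last column as `n ≥
    -- 2`.
    · have h : ¬ ∀ i, (σ i).val + 1 = n := fun h => by
        have := h (σ.symm 0)
        simp only [Equiv.apply_symm_apply, Fin.val_zero] at this
        omega
      simp only [magicSquareGame, lineCell, lineSign, if_neg h]
      norm_num
    · have h : (∀ _ : Fin n, k.val + 1 = n) ↔ k.val + 1 = n := ⟨fun h => h 0, fun h _ => h⟩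
      simp only [magicSquareGame, lineCell, lineSign, h]
      by_cases hk : k.val + 1 = n <;> simp [hk]
      norm_num
  have hs : lineSign n line = 1 ∨ lineSign n line = -1 := by
    rcases line with j | k
    · exact Or.inl rfl
    · simp only [lineSign]; split_ifs <;> simp
  rw [Finset.prod_pow_eq_pow_sum]
  simp only [hV]
  rcases Nat.even_or_odd (∑ i, (a i).val) with h | h <;> rcases hs with hs | hs <;>
    simp [hs, h, h.neg_one_pow] <;> norm_num [h]

/-- The expectation of the product of the `±1`-valued answers to the questions `q`. -/
noncomputable def CommutingOperatorStrategy.correlation {m : ℕ} {Q : Type} {H : Type*}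
    [NormedAddCommGroup H] [InnerProductSpace ℂ H] [CompleteSpace H]
    (S : CommutingOperatorStrategy m Q (Fin 2) H) (q : Fin m → Q) : ℝ :=
  (opTrace (S.state * (List.ofFn fun i => S.meas i (q i) 0 - S.meas i (q i) 1).prod)).re

section Strategies

variable {H : Type*} [NormedAddCommGroup H] [InnerProductSpace ℂ H] [CompleteSpace H]

/-- Multilinear expansion. The weights `z = 1` give the total probability, and `z e = (-1) ^ e` the
correlation. -/
theorem CommutingOperatorStrategy.sum_behavior_mul_prod {m : ℕ} {Q : Type}
    (S : CommutingOperatorStrategy m Q (Fin 2) H) (q : Fin m → Q) (z : Fin 2 → ℝ) :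
    ∑ a, S.behavior q a * ∏ i, z (a i) = (opTrace (S.state *
      (List.ofFn fun i => ∑ e, (z e : ℂ) • S.meas i (q i) e).prod)).re := by
  have h := (MultilinearMap.mkPiAlgebraFin ℂ m (H →L[ℂ] H)).map_sum
    (fun i e => (z e : ℂ) • S.meas i (q i) e)
  simp only [MultilinearMap.map_smul_univ, MultilinearMap.mkPiAlgebraFin_apply] at h
  rw [h, S.isDensityOperator_state.opTrace_mul_sum, Complex.re_sum]
  refine Finset.sum_congr rfl fun a _ => ?_
  rw [← Complex.ofReal_prod, Complex.re_ofReal_mul, mul_comm]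
  rfl

theorem winProb_magicSquareGame {n : ℕ} [NeZero n] (hn : 2 ≤ n)
    (S : CommutingOperatorStrategy n (Fin n × Fin n) (Fin 2) H) :
    (magicSquareGame n).winProb S.behavior = (1 + (2 * n : ℝ)⁻¹ * ((n.factorial : ℝ)⁻¹ *
      ∑ line, ∑ σ : Equiv.Perm (Fin n),
        lineSign n line * S.correlation (fun i => lineCell line (σ i)))) / 2 := by
  have hq : ∀ (line : Fin n ⊕ Fin n) (σ : Equiv.Perm (Fin n)),
      ∑ a : Fin n → Fin 2, S.behavior (fun i => lineCell line (σ i)) a *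
      ((1 + lineSign n line * ∏ i, (-1) ^ (a i).val) / 2)
      = (1 + lineSign n line * S.correlation (fun i => lineCell line (σ i))) / 2 := by
    intro line σ
    have h1 := S.sum_behavior_mul_prod (fun i => lineCell line (σ i)) (fun _ => 1)
    have h2 := S.sum_behavior_mul_prod (fun i => lineCell line (σ i)) (fun e => (-1) ^ e.val)
    have hone : ∀ i q, ∑ e, S.meas i q e = 1 := fun i q => (S.isPOVM_meas i q).sum_eq_one
    simp only [Complex.ofReal_one, one_smul, hone] at h1
    simp only [List.ofFn_const, List.prod_replicate, one_pow,
      Finset.prod_const_one, mul_one, S.isDensityOperator_state.opTrace_eq_one,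
      Complex.one_re] at h1
    simp only [Fin.sum_univ_two, Fin.val_zero, Fin.val_one, pow_zero, pow_one, Complex.ofReal_one,
      one_smul, Complex.ofReal_neg, neg_smul, ← sub_eq_add_neg] at h2
    have h3 : ∀ a, S.behavior (fun i => lineCell line (σ i)) a *
        ((1 + lineSign n line * ∏ i, (-1) ^ (a i).val) / 2)
        = (S.behavior (fun i => lineCell line (σ i)) a + lineSign n line *
          (S.behavior (fun i => lineCell line (σ i)) a * ∏ i, (-1) ^ (a i).val)) / 2 :=
      fun a => by ring
    simp only [h3, ← Finset.sum_div, Finset.sum_add_distrib, ← Finset.mul_sum, h1, h2]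
    rfl
  have hcard : ((Fintype.card (Fin n ⊕ Fin n) : ENNReal)⁻¹).toReal = (2 * n : ℝ)⁻¹ := by
    rw [ENNReal.toReal_inv, ENNReal.toReal_natCast, Fintype.card_sum, Fintype.card_fin]
    push_cast; ring
  have hcard' : ((Fintype.card (Equiv.Perm (Fin n)) : ENNReal)⁻¹).toReal
      = (n.factorial : ℝ)⁻¹ := by
    rw [ENNReal.toReal_inv, ENNReal.toReal_natCast, Fintype.card_perm, Fintype.card_fin]
  have hdist : (magicSquareGame n).questionDist =
      (PMF.uniformOfFintype (Fin n ⊕ Fin n)).bind fun line =>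
        (PMF.uniformOfFintype (Equiv.Perm (Fin n))).map fun σ i => lineCell line (σ i) := rfl
  simp only [Game.winProb, hdist, PMF.sum_bind_toReal_mul, PMF.sum_map_toReal_mul,
    PMF.uniformOfFintype_apply, hcard, hcard']
  have hn0 : (n : ℝ) ≠ 0 := by positivity
  have hf0 : (n.factorial : ℝ) ≠ 0 := by positivity
  simp only [magicSquareGame_V_lineCell hn, hq, ← Finset.mul_sum, ← Finset.sum_div,
    Finset.sum_add_distrib, Finset.sum_const,
    Finset.card_univ, Fintype.card_perm, Fintype.card_fin, Fintype.card_sum, nsmul_eq_mul, mul_one]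
  push_cast
  field_simp
  ring

end Strategies

/-! ### The Latin square and the alternating order of the lines -/

/-- The cell of the given line in which the Latin square `(j, k) ↦ j + k` has the entry `c`. -/
def latinCell {n : ℕ} [NeZero n] (c : Fin n) : Fin n ⊕ Fin n → Fin n × Fin n
  | Sum.inl j => (j, c - j)
  | Sum.inr k => (c - k, k)

/-- Subtracting the index of the line is a permutation of the symbols. The gain is that the same `τ`
can serve all lines at once. -/
theorem sum_perm_lineCell {n : ℕ} [NeZero n] (line : Fin n ⊕ Fin n)
    (F : (Fin n → Fin n × Fin n) → ℝ) :
    ∑ σ : Equiv.Perm (Fin n), F (fun i => lineCell line (σ i))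
      = ∑ τ : Equiv.Perm (Fin n), F (fun i => latinCell (τ i) line) := by
  rcases line with j | j <;>
  exact (Fintype.sum_equiv (Equiv.mulLeft (Equiv.subRight j : Equiv.Perm (Fin n))) _ _
    fun _ => rfl).symm

/-- The rows and columns in alternation: row `0`, column `0`, row `1`, column `1`, and so on. -/
def lineAt (n : ℕ) [NeZero n] (a : ℕ) : Fin n ⊕ Fin n :=
  if Even a then Sum.inl (Fin.ofNat n (a / 2)) else Sum.inr (Fin.ofNat n (a / 2))

theorem lineAt_two_mul (n : ℕ) [NeZero n] (j : ℕ) : lineAt n (2 * j) = Sum.inl (Fin.ofNat n j) := by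
  simp [lineAt]

theorem lineAt_two_mul_add_one (n : ℕ) [NeZero n] (j : ℕ) :
    lineAt n (2 * j + 1) = Sum.inr (Fin.ofNat n j) := by
  have : (2 * j + 1) / 2 = j := by omega
  simp [lineAt, this]

theorem Finset.sum_range_two_mul {M : Type*} [AddCommMonoid M] (f : ℕ → M) (m : ℕ) :
    ∑ a ∈ range (2 * m), f a = ∑ j ∈ range m, f (2 * j) + ∑ j ∈ range m, f (2 * j + 1) := by
  induction m with
  | zero => simp
  | succ m ih =>
    rw [show 2 * (m + 1) = 2 * m + 1 + 1 by ring, sum_range_succ, sum_range_succ, ih,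
      sum_range_succ, sum_range_succ]
    abel

theorem sum_lineAt {M : Type*} [AddCommMonoid M] {n : ℕ} [NeZero n] (G : Fin n ⊕ Fin n → M) :
    ∑ line, G line = ∑ a ∈ Finset.range (2 * n), G (lineAt n a) := by
  rw [Finset.sum_range_two_mul, Fintype.sum_sum_type]
  simp only [lineAt_two_mul, lineAt_two_mul_add_one]
  rw [← Fin.sum_univ_eq_sum_range (fun j => G (Sum.inl (Fin.ofNat n j))),
    ← Fin.sum_univ_eq_sum_range (fun j => G (Sum.inr (Fin.ofNat n j)))]
  simp

theorem lineSign_lineAt {n : ℕ} [NeZero n] {a : ℕ} (ha : a < 2 * n) :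
    lineSign n (lineAt n a) = if a + 1 = 2 * n then -1 else 1 := by
  obtain ⟨j, rfl | rfl⟩ := Nat.even_or_odd' a
  · rw [lineAt_two_mul, if_neg (by omega)]; rfl
  · rw [lineAt_two_mul_add_one]
    have : j % n = j := Nat.mod_eq_of_lt (by omega)
    simp only [lineSign, Fin.val_ofNat, this]
    congr 1
    simp only [eq_iff_iff]
    omega

/-- Row `j` and column `k` stand at the positions `2j` and `2k + 1`, so the two cases, without and
with wrap-around modulo `n`, are the two reflections of a player's word. -/
theorem latinCell_inl_eq_inr {n : ℕ} [NeZero n] {c : Fin n} {j k : ℕ}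
    (h : j + k = (c : ℕ) ∨ j + k = c + n) :
    latinCell c (Sum.inl (Fin.ofNat n j)) = latinCell c (Sum.inr (Fin.ofNat n k)) := by
  have hc : Fin.ofNat n j + Fin.ofNat n k = c := by
    ext
    have : (j + k) % n = c := by
      rcases h with h | h <;> rw [h] <;> simp [Nat.mod_eq_of_lt c.2]
    simpa [Fin.val_add] using this
  simp [latinCell, ← hc]

/-! ### The upper bound for commuting-operator strategies -/

section UpperBound

variable {H : Type*} [NormedAddCommGroup H] [InnerProductSpace ℂ H] [CompleteSpace H]

theorem sum_lineSign_mul_correlation_le {n : ℕ} [NeZero n]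
    (S : CommutingOperatorStrategy n (Fin n × Fin n) (Fin 2) H) (c : Fin n → Fin n) :
    ∑ line, lineSign n line * S.correlation (fun i => latinCell (c i) line)
      ≤ 2 * n * Real.cos (Real.pi / (2 * n)) := by
  choose V hV01 hV10 hVs hVA hVc using fun i q => exists_unitary_average (S.isPOVM_meas i q)
  have hVV : ∀ i q e, V i q e * V i q (1 - e) = 1 := fun i q e => by
    fin_cases e
    · exact hV01 i q
    · exact hV10 i q
  have hVV' : ∀ i q e, V i q (1 - e) * V i q e = 1 := fun i q e => by
    simpa using hVV i q (1 - e)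
  have hcomm : ∀ i j, i ≠ j → ∀ q q' e e', Commute (V i q e) (V j q' e') :=
    fun i j hij q q' e e' => hVc i q _
      (hVc j q' _ (S.commute_meas j i hij.symm _ _ _ _) (S.commute_meas j i hij.symm _ _ _ _) e').symm
      (hVc j q' _ (S.commute_meas j i hij.symm _ _ _ _) (S.commute_meas j i hij.symm _ _ _ _) e').symm
      e
  -- Rows stand at even positions and columns at odd ones. The flip at columns makes a player's
  -- second visit to a cell undo the first, and leaves the average over `e` unchanged.
  let s : Fin 2 → ℕ → Fin 2 := fun e a => if Even a then e else 1 - e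
  let u : (Fin n → Fin 2) → Fin n → ℕ → H →L[ℂ] H := fun ε i a =>
    V i (latinCell (c i) (lineAt n a)) (s (ε i) a)
  let A : Fin n ⊕ Fin n → H →L[ℂ] H := fun line => (List.ofFn fun i =>
    S.meas i (latinCell (c i) line) 0 - S.meas i (latinCell (c i) line) 1).prod
  have hA : ∀ a, A (lineAt n a)
      = ∑ ε, ((2⁻¹ : ℂ) ^ n) • (List.ofFn fun i => u ε i a).prod := fun a => by
    refine List.prod_ofFn_eq_average _
      (fun i e => V i (latinCell (c i) (lineAt n a)) (s e a)) fun i => ?_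
    rw [← hVA]
    by_cases ha : Even a
    · simp only [s, if_pos ha]
    · simp only [s, if_neg ha]
      exact (Equiv.subLeft (1 : Fin 2)).sum_comp
        fun e => (2⁻¹ : ℂ) • V i (latinCell (c i) (lineAt n a)) e
  have hword : ∀ ε ψ, ∑ a ∈ Finset.range (2 * n), lineSign n (lineAt n a) *
        (inner ℂ ψ ((List.ofFn fun i => u ε i a).prod ψ)).re
      ≤ 2 * n * Real.cos (Real.pi / (2 * n)) * ‖ψ‖ ^ 2 := fun ε ψ => by
    refine le_of_eq_of_le (Finset.sum_congr rfl fun a ha => ?_)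
      (sum_re_inner_prod_le (NeZero.one_le) c (u ε) (fun i j hij a b => hcomm i j hij _ _ _ _)
        (fun i a => ?_) (fun i a b hab => ?_) ψ)
    · rw [lineSign_lineAt (Finset.mem_range.1 ha)]
    · simp only [u, hVs, hVV']
    -- As `a + b` is odd, one position is a row and the other a column, and they meet in the
    -- player's cell.
    · obtain ⟨j, rfl | rfl⟩ := Nat.even_or_odd' a <;> obtain ⟨k, rfl | rfl⟩ := Nat.even_or_odd' b
      · omega
      · have := latinCell_inl_eq_inr (c := c i) (j := j) (k := k) (by omega)
        simp only [u, s, lineAt_two_mul, lineAt_two_mul_add_one, this, even_two_mul,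
          if_true, Nat.not_even_two_mul_add_one, if_false, hVV]
      · have := latinCell_inl_eq_inr (c := c i) (j := k) (k := j) (by omega)
        simp only [u, s, lineAt_two_mul, lineAt_two_mul_add_one, this, even_two_mul,
          if_true, Nat.not_even_two_mul_add_one, if_false, hVV']
      · omega
  have hsum : ∑ line, lineSign n line * S.correlation (fun i => latinCell (c i) line)
      = (opTrace (S.state * ∑ line, (lineSign n line : ℂ) • A line)).re := by
    rw [S.isDensityOperator_state.opTrace_mul_sum, Complex.re_sum]
    simp only [Complex.re_ofReal_mul]
    rfl
  rw [hsum]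
  refine S.isDensityOperator_state.re_opTrace_mul_le fun ψ => ?_
  rw [sum_lineAt fun line => (lineSign n line : ℂ) • A line]
  have hre : ∀ z : ℂ, ((2⁻¹ : ℂ) ^ n * z).re = (2⁻¹ : ℝ) ^ n * z.re := fun z => by
    rw [← Complex.re_ofReal_mul]; norm_num
  have hexp : (inner ℂ ψ ((∑ a ∈ Finset.range (2 * n),
      (lineSign n (lineAt n a) : ℂ) • A (lineAt n a)) ψ)).re
      = (2⁻¹ : ℝ) ^ n * ∑ ε, ∑ a ∈ Finset.range (2 * n), lineSign n (lineAt n a) *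
        (inner ℂ ψ ((List.ofFn fun i => u ε i a).prod ψ)).re := by
    simp only [hA, sum_apply, smul_apply, inner_sum, inner_smul_right, Complex.re_sum,
      Complex.re_ofReal_mul, hre, Finset.mul_sum]
    rw [Finset.sum_comm]
    exact Finset.sum_congr rfl fun ε _ => Finset.sum_congr rfl fun a _ => by ring
  rw [hexp]
  calc _ ≤ (2⁻¹ : ℝ) ^ n * ∑ _ε : Fin n → Fin 2, 2 * n * Real.cos (Real.pi / (2 * n)) * ‖ψ‖ ^ 2 := by
        gcongr with ε
        exact hword ε ψ
    _ = _ := by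
      simp only [Finset.sum_const, Finset.card_univ, Fintype.card_fun, Fintype.card_fin,
        nsmul_eq_mul]
      push_cast
      rw [← mul_assoc, ← mul_pow]
      norm_num

theorem winProb_magicSquareGame_le {n : ℕ} [NeZero n] (hn : 2 ≤ n)
    (S : CommutingOperatorStrategy n (Fin n × Fin n) (Fin 2) H) :
    (magicSquareGame n).winProb S.behavior ≤ (1 + Real.cos (Real.pi / (2 * n))) / 2 := by
  rw [winProb_magicSquareGame hn]
  simp only [← Finset.mul_sum, sum_perm_lineCell _ S.correlation]
  simp only [Finset.mul_sum]
  rw [Finset.sum_comm]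
  have hf0 : (0 : ℝ) < n.factorial := by positivity
  have hn0 : (0 : ℝ) < n := by positivity
  have h : ∑ τ : Equiv.Perm (Fin n), ∑ line, lineSign n line *
        S.correlation (fun i => latinCell (τ i) line)
      ≤ n.factorial * (2 * n * Real.cos (Real.pi / (2 * n))) := by
    have := Finset.sum_le_card_nsmul Finset.univ _ _ fun (τ : Equiv.Perm (Fin n)) _ =>
      sum_lineSign_mul_correlation_le S τ
    rwa [Finset.card_univ, Fintype.card_perm, Fintype.card_fin, nsmul_eq_mul] at this
  have h2 := mul_le_mul_of_nonneg_left h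
    (show 0 ≤ (2 * n : ℝ)⁻¹ * (n.factorial : ℝ)⁻¹ by positivity)
  have h3 : (2 * n : ℝ)⁻¹ * (n.factorial : ℝ)⁻¹ *
      (n.factorial * (2 * n * Real.cos (Real.pi / (2 * n)))) = Real.cos (Real.pi / (2 * n)) := by
    field_simp
  rw [h3, mul_assoc] at h2
  simp only [Finset.mul_sum] at h2 ⊢
  linarith

end UpperBound

/-! ### The GHZ strategy attaining the bound -/

section PureStates

variable {H : Type*} [NormedAddCommGroup H] [InnerProductSpace ℂ H] [CompleteSpace H]

open InnerProductSpace in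
theorem hasSum_inner_rankOne_mul {ι : Type*} (b : HilbertBasis ι ℂ H) (φ : H) (T : H →L[ℂ] H) :
    HasSum (fun e => inner ℂ (b e) ((rankOne ℂ φ φ * T) (b e))) (inner ℂ φ (T φ)) := by
  have h := b.hasSum_inner_mul_inner (ContinuousLinearMap.adjoint T φ) φ
  simpa only [ContinuousLinearMap.adjoint_inner_left, mul_apply_eq_comp, rankOne_apply,
    inner_smul_right] using h

open InnerProductSpace in
theorem isDensityOperator_rankOne {φ : H} (hφ : inner ℂ φ φ = (1 : ℂ)) :
    IsDensityOperator (rankOne ℂ φ φ) where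
  isPositive := isPositive_rankOne_self φ
  hasSum_trace := by
    simpa only [mul_one, one_apply_eq_self, hφ] using
      hasSum_inner_rankOne_mul (stdHilbertBasis H) φ 1

end PureStates

section LocalOps

variable {m : ℕ} {H : Fin m → Type*} [∀ i, NormedAddCommGroup (H i)]
  [∀ i, InnerProductSpace ℂ (H i)] [∀ i, CompleteSpace (H i)]

theorem localOp_sub (i : Fin m) (S T : H i →L[ℂ] H i) :
    localOp i (S - T) = localOp i S - localOp i T := by
  rw [eq_sub_iff_add_eq, ← localOp_add, sub_add_cancel]

theorem prod_ofFn_localOp_tprod (X : ∀ i, H i →L[ℂ] H i) (x : ∀ i, H i) :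
    (List.ofFn fun i => localOp i (X i)).prod (AlgTensor.tprod H x : HilbertTensor H)
      = (AlgTensor.tprod H (fun i => X i (x i)) : AlgTensor H) := by
  -- Generalised to lists without repetition, so that each operator still meets the original vector
  -- `x i`.
  have key : ∀ l : List (Fin m), l.Nodup →
      (l.map fun i => localOp i (X i)).prod (AlgTensor.tprod H x : HilbertTensor H)
        = (AlgTensor.tprod H (fun i => if i ∈ l then X i (x i) else x i) : AlgTensor H) := by
    intro l
    induction l with
    | nil => intro _; simp
    | cons i l ih =>
      intro h
      rw [List.nodup_cons] at h
      rw [List.map_cons, List.prod_cons, mul_apply_eq_comp, ih h.2, localOp_coe,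
        AlgTensor.localMap_tprod, if_neg h.1]
      congr 2
      funext j
      by_cases hj : j = i
      · subst hj; simp
      · simp [hj]
  rw [List.ofFn_eq_map, key _ (List.nodup_finRange m)]
  simp

end LocalOps

section Qubit

variable {K : Type*} [NormedAddCommGroup K] [InnerProductSpace ℂ K]

open InnerProductSpace in
/-- The projective measurement of a qubit in the basis `(|0⟩ ± exp (iθ) |1⟩) / √2`. -/
noncomputable def equatorialMeas (e : OrthonormalBasis (Fin 2) ℂ K) (θ : ℝ) (a : Fin 2) :
    K →L[ℂ] K :=
  (2⁻¹ : ℝ) • rankOne ℂ (e 0 + ((-1) ^ a.val * Complex.exp (θ * Complex.I)) • e 1)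
    (e 0 + ((-1) ^ a.val * Complex.exp (θ * Complex.I)) • e 1)

theorem conj_exp_mul_I (θ : ℝ) :
    (starRingEnd ℂ) (Complex.exp (θ * Complex.I)) = Complex.exp (-(θ * Complex.I)) := by
  rw [← Complex.exp_conj, map_mul, Complex.conj_ofReal, Complex.conj_I, mul_neg]

theorem equatorialMeas_sub_apply_zero (e : OrthonormalBasis (Fin 2) ℂ K) (θ : ℝ) :
    (equatorialMeas e θ 0 - equatorialMeas e θ 1) (e 0) = Complex.exp (θ * Complex.I) • e 1 := by
  have h01 : inner ℂ (e 1) (e 0) = (0 : ℂ) := e.orthonormal.2 (by decide)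
  have h00 : inner ℂ (e 0) (e 0) = (1 : ℂ) := by simp [inner_self_eq_norm_sq_to_K]
  simp only [equatorialMeas, sub_apply, smul_apply,
    InnerProductSpace.rankOne_apply, inner_add_left, inner_smul_left, h01, h00,
    Fin.val_zero, Fin.val_one, pow_zero, pow_one, ← Complex.coe_smul]
  match_scalars
  · ring
  · ring

theorem equatorialMeas_sub_apply_one (e : OrthonormalBasis (Fin 2) ℂ K) (θ : ℝ) :
    (equatorialMeas e θ 0 - equatorialMeas e θ 1) (e 1)
      = Complex.exp (-(θ * Complex.I)) • e 0 := by
  have h01 : inner ℂ (e 0) (e 1) = (0 : ℂ) := e.orthonormal.2 (by decide)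
  have h11 : inner ℂ (e 1) (e 1) = (1 : ℂ) := by simp [inner_self_eq_norm_sq_to_K]
  simp only [equatorialMeas, sub_apply, smul_apply,
    InnerProductSpace.rankOne_apply, inner_add_left, inner_smul_left, h01, h11, map_mul, map_neg,
    map_one, conj_exp_mul_I, Fin.val_zero, Fin.val_one, pow_zero, pow_one, ← Complex.coe_smul]
  match_scalars
  · ring
  · ring

theorem isPOVM_equatorialMeas [CompleteSpace K] (e : OrthonormalBasis (Fin 2) ℂ K) (θ : ℝ) :
    IsPOVM (equatorialMeas e θ) where
  isPositive a := (ContinuousLinearMap.nonneg_iff_isPositive _).1 <|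
    smul_nonneg (by norm_num) <| (ContinuousLinearMap.nonneg_iff_isPositive _).2 <|
      InnerProductSpace.isPositive_rankOne_self _
  sum_eq_one := by
    have h : Complex.exp (-(θ * Complex.I)) * Complex.exp (θ * Complex.I) = 1 := by
      rw [← Complex.exp_add]; simp
    ext x
    conv_rhs => rw [one_apply_eq_self, ← e.sum_repr' x]
    simp only [Fin.sum_univ_two, equatorialMeas, add_apply, smul_apply,
      InnerProductSpace.rankOne_apply, inner_add_left, inner_smul_left, map_mul, conj_exp_mul_I,
      Fin.val_zero, Fin.val_one, pow_zero, pow_one, map_one, map_neg, ← Complex.coe_smul]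
    match_scalars
    · ring
    · linear_combination (inner ℂ (e 1) x) * h

end Qubit

section GHZ

variable {K : Type*} [NormedAddCommGroup K] [InnerProductSpace ℂ K]

/-- The Greenberger–Horne–Zeilinger state `(|0…0⟩ + |1…1⟩) / √2`. -/
noncomputable def ghzVector (n : ℕ) (e : OrthonormalBasis (Fin 2) ℂ K) :
    HilbertTensor (fun _ : Fin n => K) :=
  ((√2 : ℂ)⁻¹ • (AlgTensor.tprod _ (fun _ => e 0) + AlgTensor.tprod _ (fun _ => e 1)) :
    AlgTensor (fun _ : Fin n => K))

theorem inner_tprod_const {n : ℕ} [NeZero n] (e : OrthonormalBasis (Fin 2) ℂ K) (j k : Fin 2) :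
    inner ℂ (AlgTensor.tprod (fun _ : Fin n => K) fun _ => e j) (AlgTensor.tprod _ fun _ => e k)
      = if j = k then (1 : ℂ) else 0 := by
  rw [AlgTensor.inner_tprod, Finset.prod_const, orthonormal_iff_ite.1 e.orthonormal]
  split_ifs <;> simp [NeZero.ne n]

theorem inv_sqrt_two_mul_self : (√2 : ℂ)⁻¹ * (√2 : ℂ)⁻¹ = 2⁻¹ := by
  rw [← mul_inv, ← Complex.ofReal_mul, Real.mul_self_sqrt (by norm_num)]; norm_num

theorem inner_ghzVector_self {n : ℕ} [NeZero n] (e : OrthonormalBasis (Fin 2) ℂ K) :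
    inner ℂ (ghzVector n e) (ghzVector n e) = (1 : ℂ) := by
  rw [ghzVector, UniformSpace.Completion.inner_coe]
  simp only [inner_smul_left, inner_smul_right, inner_add_left, inner_add_right,
    inner_tprod_const, map_inv₀, Complex.conj_ofReal]
  simp only [if_true, zero_ne_one, one_ne_zero, if_false, add_zero, zero_add]
  linear_combination 2 * inv_sqrt_two_mul_self

variable [CompleteSpace K]

/-- The operators exchange the two branches of the GHZ state, with phases `exp (± i ∑ θ)`; the
branches are orthonormal since `n ≥ 1`, so the mean of the phases remains. -/
theorem inner_ghzVector_prod {n : ℕ} [NeZero n] (e : OrthonormalBasis (Fin 2) ℂ K)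
    (X : Fin n → K →L[ℂ] K) (θ : Fin n → ℝ)
    (h0 : ∀ i, X i (e 0) = Complex.exp (θ i * Complex.I) • e 1)
    (h1 : ∀ i, X i (e 1) = Complex.exp (-(θ i * Complex.I)) • e 0) :
    inner ℂ (ghzVector n e) ((List.ofFn fun i =>
      localOp (H := fun _ : Fin n => K) i (X i)).prod (ghzVector n e))
      = (Real.cos (∑ i, θ i) : ℂ) := by
  have hp : ∏ i, Complex.exp (θ i * Complex.I) = Complex.exp ((∑ i, θ i : ℝ) * Complex.I) := by
    rw [← Complex.exp_sum, ← Finset.sum_mul]; push_cast; rfl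
  have hm : ∏ i, Complex.exp (-(θ i * Complex.I))
      = Complex.exp (-((∑ i, θ i : ℝ) * Complex.I)) := by
    rw [← Complex.exp_sum, Finset.sum_neg_distrib, ← Finset.sum_mul]; push_cast; rfl
  simp only [ghzVector, UniformSpace.Completion.coe_smul, UniformSpace.Completion.coe_add, map_smul,
    map_add, prod_ofFn_localOp_tprod, h0, h1, MultilinearMap.map_smul_univ, hp, hm,
    inner_smul_left, inner_smul_right, inner_add_left, inner_add_right,
    UniformSpace.Completion.inner_coe, inner_tprod_const, map_inv₀, Complex.conj_ofReal]
  simp only [if_true, zero_ne_one, one_ne_zero, if_false, mul_one, add_zero, zero_add]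
  rw [Complex.ofReal_cos, Complex.cos, neg_mul]
  linear_combination (Complex.exp ((∑ i, θ i : ℝ) * Complex.I) +
    Complex.exp (-((∑ i, θ i : ℝ) * Complex.I))) * inv_sqrt_two_mul_self

/-- All players share a GHZ state and measure it in equatorial bases, the angle depending on the
question only. -/
noncomputable def ghzStrategy (n : ℕ) [NeZero n] {Q : Type} (e : OrthonormalBasis (Fin 2) ℂ K)
    (θ : Q → ℝ) : EntangledStrategy n Q (Fin 2) (fun _ => K) where
  state := InnerProductSpace.rankOne ℂ (ghzVector n e) (ghzVector n e)
  isDensityOperator_state := isDensityOperator_rankOne (inner_ghzVector_self e)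
  meas _ q := equatorialMeas e (θ q)
  isPOVM_meas _ q := isPOVM_equatorialMeas e (θ q)

theorem correlation_ghzStrategy {n : ℕ} [NeZero n] {Q : Type} (e : OrthonormalBasis (Fin 2) ℂ K)
    (θ : Q → ℝ) (q : Fin n → Q) :
    (ghzStrategy n e θ).toCommuting.correlation q = Real.cos (∑ i, θ (q i)) := by
  have h := inner_ghzVector_prod e
    (fun i => equatorialMeas e (θ (q i)) 0 - equatorialMeas e (θ (q i)) 1) (fun i => θ (q i))
    (fun i => equatorialMeas_sub_apply_zero e _) (fun i => equatorialMeas_sub_apply_one e _)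
  simp only [localOp_sub] at h
  rw [← Complex.ofReal_re (Real.cos _), ← h, ← (hasSum_inner_rankOne_mul _ _ _).tsum_eq]
  rfl

end GHZ

/-- Measurement angles whose sum is `π / (2n)` along a row, `-π / (2n)` along every column but
the last one, and `π - π / (2n)` along the last column. -/
noncomputable def magicSquareAngle (n : ℕ) (q : Fin n × Fin n) : ℝ :=
  (if q.2.val + 1 = n then Real.pi / n else 0) - Real.pi / (2 * n ^ 2)

theorem lineSign_mul_cos_magicSquareAngle {n : ℕ} [NeZero n] (line : Fin n ⊕ Fin n)
    (σ : Equiv.Perm (Fin n)) :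
    lineSign n line * Real.cos (∑ i, magicSquareAngle n (lineCell line (σ i)))
      = Real.cos (Real.pi / (2 * n)) := by
  have hn : (n : ℝ) ≠ 0 := NeZero.ne _
  rw [σ.sum_comp Finset.univ (fun i => magicSquareAngle n (lineCell line i)) (by simp)]
  rcases line with j | k
  · have hlast : ∑ k : Fin n, (if k.val + 1 = n then Real.pi / n else 0) = Real.pi / n := by
      have hpos : 0 < n := NeZero.pos n
      rw [Finset.sum_eq_single (⟨n - 1, by omega⟩ : Fin n)]
      · exact if_pos (by simp only; omega)
      · intro k _ hk
        exact if_neg fun h => hk (Fin.ext (by simp only; omega))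
      · simp
    have hsum : ∑ k, magicSquareAngle n (lineCell (Sum.inl j) k) = Real.pi / (2 * n) := by
      change ∑ k : Fin n, ((if k.val + 1 = n then Real.pi / n else 0) - Real.pi / (2 * n ^ 2)) = _
      rw [Finset.sum_sub_distrib, hlast, Finset.sum_const, Finset.card_univ, Fintype.card_fin,
        nsmul_eq_mul]
      field_simp
      ring
    rw [hsum, lineSign, one_mul]
  · have hsum : ∑ i, magicSquareAngle n (lineCell (Sum.inr k) i)
        = n * magicSquareAngle n (k, k) := by
      change ∑ _i : Fin n, magicSquareAngle n (k, k) = _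
      rw [Finset.sum_const, Finset.card_univ, Fintype.card_fin, nsmul_eq_mul]
    rw [hsum]
    simp only [magicSquareAngle, lineSign]
    split_ifs with hk
    · have : (n : ℝ) * (Real.pi / n - Real.pi / (2 * n ^ 2)) = Real.pi - Real.pi / (2 * n) := by
        field_simp
      rw [this, Real.cos_pi_sub]; ring
    · have : (n : ℝ) * (0 - Real.pi / (2 * n ^ 2)) = -(Real.pi / (2 * n)) := by
        field_simp; ring
      rw [this, Real.cos_neg, one_mul]

theorem winProb_ghzStrategy {K : Type*} [NormedAddCommGroup K] [InnerProductSpace ℂ K]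
    [CompleteSpace K] {n : ℕ} [NeZero n] (hn : 2 ≤ n) (e : OrthonormalBasis (Fin 2) ℂ K) :
    (magicSquareGame n).winProb (ghzStrategy n e (magicSquareAngle n)).toCommuting.behavior
      = (1 + Real.cos (Real.pi / (2 * n))) / 2 := by
  rw [winProb_magicSquareGame hn]
  simp only [correlation_ghzStrategy, lineSign_mul_cos_magicSquareAngle, Finset.sum_const,
    Finset.card_univ, Fintype.card_perm, Fintype.card_sum, Fintype.card_fin, nsmul_eq_mul]
  have hn0 : (n : ℝ) ≠ 0 := NeZero.ne _
  have hf0 : (n.factorial : ℝ) ≠ 0 := by positivity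
  push_cast
  field_simp
  ring

/-! ### Comparison of the three classes of strategies -/

theorem Game.finDimEntangledWinProbs_subset {m : ℕ} {Q A : Type} [Fintype Q] [Fintype A]
    (G : Game m Q A) : G.finDimEntangledWinProbs.{u} ⊆ G.entangledWinProbs.{u} := by
  rintro w ⟨H, i1, i2, i3, -, S, hS⟩
  exact ⟨H, i1, i2, i3, S, hS⟩

theorem Game.entangledWinProbs_subset {m : ℕ} {Q A : Type} [Fintype Q] [Fintype A]
    (G : Game m Q A) : G.entangledWinProbs.{u} ⊆ G.commutingWinProbs.{u} := by
  rintro w ⟨H, i1, i2, i3, S, hS⟩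
  exact ⟨HilbertTensor H, inferInstance, inferInstance, inferInstance, S.toCommuting, hS⟩

theorem mainTheorem2 (n : ℕ) [NeZero n] (hn : 2 ≤ n) :
    IsGreatest (magicSquareGame n).commutingWinProbs.{u} ((1 + Real.cos (Real.pi / (2 * n))) / 2) ∧
    IsGreatest (magicSquareGame n).entangledWinProbs.{u} ((1 + Real.cos (Real.pi / (2 * n))) / 2) ∧
    IsGreatest (magicSquareGame n).finDimEntangledWinProbs.{u}
      ((1 + Real.cos (Real.pi / (2 * n))) / 2) := by
  have hfin : (1 + Real.cos (Real.pi / (2 * n))) / 2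
      ∈ (magicSquareGame n).finDimEntangledWinProbs.{u} :=
    -- One qubit per player, with the index type lifted so that the space lives in the universe `u`.
    ⟨fun _ => EuclideanSpace ℂ (ULift.{u} (Fin 2)), inferInstance, inferInstance, inferInstance,
      inferInstance, ghzStrategy n ((EuclideanSpace.basisFun (ULift.{u} (Fin 2)) ℂ).reindex
        Equiv.ulift) (magicSquareAngle n), (winProb_ghzStrategy hn _).symm⟩
  have hent := (magicSquareGame n).finDimEntangledWinProbs_subset hfin
  have hcom := (magicSquareGame n).entangledWinProbs_subset hent
  have hle : (1 + Real.cos (Real.pi / (2 * n))) / 2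
      ∈ upperBounds (magicSquareGame n).commutingWinProbs.{u} := by
    rintro w ⟨H, i1, i2, i3, S, rfl⟩
    exact winProb_magicSquareGame_le hn S
  have hle' := upperBounds_mono_set (magicSquareGame n).entangledWinProbs_subset hle
  exact ⟨⟨hcom, hle⟩, ⟨hent, hle'⟩,
    ⟨hfin, upperBounds_mono_set (magicSquareGame n).finDimEntangledWinProbs_subset hle'⟩⟩
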